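/- Let $n\ge 2$ and let $M$ be a smooth (Hausdorff) $(n+1)$-dimensional manifold with a transversely oriented codimension-one foliation $\mathcal F$. For a Riemannian metric $g$ on $M$ let $\nabla$ be its Levi-Civita connection, $N$ the positively oriented $g$-unit normal field of $\mathcal F$, $A$ the Weingarten operator, $A(X)=-\nabla_XN$ for $X\in T\mathcal F$, extended by $A(N)=0$, and let $\tau_i=\operatorname{tr}\big((A|_{T\mathcal F})^i\big)=k_1^i+\dots+k_n^i$ $(i\ge0)$ be the power sums of the principal curvatures $k_1,\dots,k_n$ of the leaves. Let $\hat b_j(X,Y)=g(A^j\hat X,\hat Y)$, where $\hat X=X-g(X,N)N$. Let $\varepsilon>0$ and let $g_t$, $t\in[0,\varepsilon)$, be a family of Riemannian metrics, smooth on $M\times[0,\varepsilon)$, which is an extrinsic geometric flow $$\partial_t g_t=\sum_{j=0}^{n-1}f_j\,\hat b_j^{\,t}\qquad\text{with } f_1=C \text{ constant and } f_j=0 \text{ for } j\neq1,$$ where $\hat b_j^{\,t}$ is formed with respect to $g_t$. Denote by $\tau_i^t$ the power sums for $g_t$, by $N$ the unit normal for $g_0$, and by $(\phi_s)$ the flow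 of the vector field $\partial_t+\frac C2N$ on $M\times\mathbb R$. Identify $M$ with each slice $M\times\{t\}$. Then: 1. for all $i\ge0$ and $t\in[0,\varepsilon)$, $\phi_{-t}$ maps $M\times\{t\}$ into $M\times\{0\}$ and $$\tau_i^t=\tau_i^0\circ\phi_{-t};$$ if the flow is only local, this holds at each point $(p,t)$ at which $\phi_{-t}$ is defined; 2. if $M$ is compact or, more generally, $N$ is complete, then $\phi$ is globally defined, and if $\tau_i^0$ is constant on $M$ for some $i$, then for all $t\in[0,\varepsilon)$ the function $\tau_i^t$ is constant, with the same value. -/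

import Mathlib

open scoped Manifold ContDiff

noncomputable section

namespace EGF

open Bundle Set Filter Topology VectorField

section LeviCivita

variable {E : Type*} [NormedAddCommGroup E] [NormedSpace ℝ E] [FiniteDimensional ℝ E] [CompleteSpace E]
  {H : Type*} [TopologicalSpace H] {I : ModelWithCorners ℝ E H}
  {M : Type*} [TopologicalSpace M] [ChartedSpace H M] [IsManifold I ∞ M]

theorem metric_mdiffAt (g : ContMDiffRiemannianMetric I ∞ E (fun p : M => TangentSpace I p))
    {X Y : (p : M) → TangentSpace I p} {x : M} (hX : MDiffAt (T% X) x) (hY : MDiffAt (T% Y) x) :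
    MDiffAt (fun x => g.inner x (X x) (Y x)) x := by
  have h : MDifferentiableAt I (I.prod 𝓘(ℝ, ℝ))
      (fun m : M => TotalSpace.mk' ℝ (E := Bundle.Trivial M ℝ) m (g.inner m (X m) (Y m))) x := by
    apply MDifferentiableAt.clm_bundle_apply₂ (F₁ := E) (F₂ := E)
    · exact (g.contMDiff x).mdifferentiableAt (by simp)
    · exact hX
    · exact hY
  simp only [mdifferentiableAt_totalSpace] at h
  exact h.2

/-- The right-hand side of the Koszul formula for `g(∇_X Y, Z)` at `x`. -/
def koszulForm (g : ContMDiffRiemannianMetric I ∞ E (fun p : M => TangentSpace I p))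
    (X Y Z : (p : M) → TangentSpace I p) (x : M) : ℝ :=
  (1 / 2) * (d% (fun p => g.inner p (Y p) (Z p)) x (X x)
    + d% (fun p => g.inner p (X p) (Z p)) x (Y x)
    - d% (fun p => g.inner p (X p) (Y p)) x (Z x)
    + g.inner x (mlieBracket I X Y x) (Z x)
    - g.inner x (mlieBracket I X Z x) (Y x)
    - g.inner x (mlieBracket I Y Z x) (X x))

variable (g : ContMDiffRiemannianMetric I ∞ E (fun p : M => TangentSpace I p))

theorem koszul_tensorialX {Y Z : (p : M) → TangentSpace I p} {x : M}
    (hY : MDiffAt (T% Y) x) (hZ : MDiffAt (T% Z) x) :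
    TensorialAt I E (fun X => koszulForm g X Y Z x) x where
  smul {f X} hf hX := by
    have e1 : (fun p => g.inner p ((f • X) p) (Z p)) = f * (fun p => g.inner p (X p) (Z p)) := by
      ext p; simp
    have e2 : (fun p => g.inner p ((f • X) p) (Y p)) = f * (fun p => g.inner p (X p) (Y p)) := by
      ext p; simp
    simp only [koszulForm, e1, e2, mvfderiv_mul hf (metric_mdiffAt g hX hZ),
      mvfderiv_mul hf (metric_mdiffAt g hX hY), mlieBracket_smul_left hf hX]
    simp [g.symm x (X x)]
    ring
  add {X X'} hX hX' := by
    have e1 (Z : (p : M) → TangentSpace I p) : (fun p => g.inner p ((X + X') p) (Z p)) =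
      (fun p => g.inner p (X p) (Z p)) + (fun p => g.inner p (X' p) (Z p)) := by
      ext p; simp
    simp only [koszulForm, e1, mvfderiv_add (metric_mdiffAt g hX hZ) (metric_mdiffAt g hX' hZ),
      mvfderiv_add (metric_mdiffAt g hX hY) (metric_mdiffAt g hX' hY), mlieBracket_add_left hX hX']
    simp
    ring

theorem koszul_tensorialZ {X Y : (p : M) → TangentSpace I p} {x : M}
    (hX : MDiffAt (T% X) x) (hY : MDiffAt (T% Y) x) :
    TensorialAt I E (fun Z => koszulForm g X Y Z x) x where
  smul {f Z} hf hZ := by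
    have e1 (X : (p : M) → TangentSpace I p) : (fun p => g.inner p (X p) ((f • Z) p)) = f * (fun p => g.inner p (X p) (Z p)) := by
      ext p; simp
    simp only [koszulForm, e1, mvfderiv_mul hf (metric_mdiffAt g hX hZ),
      mvfderiv_mul hf (metric_mdiffAt g hY hZ), mlieBracket_smul_right hf hZ]
    simp [g.symm x (Z x)]
    ring
  add {Z Z'} hZ hZ' := by
    have e1 (X : (p : M) → TangentSpace I p) : (fun p => g.inner p (X p) ((Z + Z') p)) =
      (fun p => g.inner p (X p) (Z p)) + (fun p => g.inner p (X p) (Z' p)) := by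
      ext p; simp
    simp only [koszulForm, e1, mvfderiv_add (metric_mdiffAt g hX hZ) (metric_mdiffAt g hX hZ'),
      mvfderiv_add (metric_mdiffAt g hY hZ) (metric_mdiffAt g hY hZ'), mlieBracket_add_right hZ hZ']
    simp
    ring


/-- The musical isomorphism `v ↦ g(v, ·)`. -/
def metricFlat (x : M) : TangentSpace I x ≃ₗ[ℝ] (TangentSpace I x →L[ℝ] ℝ) :=
  haveI : FiniteDimensional ℝ (TangentSpace I x) := inferInstanceAs (FiniteDimensional ℝ E)
  haveI : T2Space (TangentSpace I x) := inferInstanceAs (T2Space E)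
  LinearEquiv.ofInjectiveOfFinrankEq (g.inner x).toLinearMap
    (by
      rw [injective_iff_map_eq_zero]
      intro v hv
      by_contra h
      have h1 := g.pos x v h
      have h2 : g.inner x v v = 0 := by
        have := congrArg (fun L : TangentSpace I x →L[ℝ] ℝ => L v) hv
        simpa using this
      linarith)
    (by
      have := (LinearMap.toContinuousLinearMap (𝕜 := ℝ) (E := TangentSpace I x)
        (F' := ℝ)).finrank_eq
      rw [← this]
      exact (Subspace.dual_finrank_eq (K := ℝ) (V := TangentSpace I x)).symm)

theorem metricFlat_apply (x : M) (v w : TangentSpace I x) :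
    metricFlat g x v w = g.inner x v w := rfl

theorem inner_metricFlat_symm (x : M) (L : TangentSpace I x →L[ℝ] ℝ) (w : TangentSpace I x) :
    g.inner x ((metricFlat g x).symm L) w = L w := by
  rw [← metricFlat_apply, LinearEquiv.apply_symm_apply]

theorem metric_ext {x : M} {u v : TangentSpace I x}
    (h : ∀ w, g.inner x u w = g.inner x v w) : u = v :=
  (metricFlat g x).injective (ContinuousLinearMap.ext h)

open scoped Classical in
/-- `leviCivitaFun g Y x v` is `∇_v Y`, determined by the Koszul formula (value `0` if `Y` is not
differentiable at `x`). -/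
def leviCivitaFun (Y : (p : M) → TangentSpace I p) (x : M) :
    TangentSpace I x →L[ℝ] TangentSpace I x :=
  haveI : FiniteDimensional ℝ (TangentSpace I x) := inferInstanceAs (FiniteDimensional ℝ E)
  haveI : T2Space (TangentSpace I x) := inferInstanceAs (T2Space E)
  if hY : MDiffAt (T% Y) x then
    LinearMap.toContinuousLinearMap ((metricFlat g x).symm.toLinearMap ∘ₗ
      (TensorialAt.mkHom₂ (I := I) (F := E) (F' := E) (fun X Z => koszulForm g X Y Z x) x
        (fun _ hZ => koszul_tensorialX g hY hZ)
        (fun _ hX => koszul_tensorialZ g hX hY)).toLinearMap)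
  else 0

theorem inner_leviCivitaFun {X Y Z : (p : M) → TangentSpace I p} {x : M}
    (hX : MDiffAt (T% X) x) (hY : MDiffAt (T% Y) x) (hZ : MDiffAt (T% Z) x) :
    g.inner x (leviCivitaFun g Y x (X x)) (Z x) = koszulForm g X Y Z x := by
  simp only [leviCivitaFun, hY, dif_pos]
  refine (inner_metricFlat_symm g x _ (Z x)).trans ?_
  exact TensorialAt.mkHom₂_apply (I := I) (F := E) (F' := E)
    (Φ := fun X Z => koszulForm g X Y Z x)
    (fun _ hZ => koszul_tensorialX g hY hZ) (fun _ hX => koszul_tensorialZ g hX hY) hX hZ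

theorem leviCivita_eq {X Y : (p : M) → TangentSpace I p} {x : M}
    (hX : MDiffAt (T% X) x) (hY : MDiffAt (T% Y) x) {u : TangentSpace I x}
    (h : ∀ Z : (p : M) → TangentSpace I p, MDiffAt (T% Z) x →
      koszulForm g X Y Z x = g.inner x u (Z x)) :
    leviCivitaFun g Y x (X x) = u := by
  refine metric_ext g fun w => ?_
  have hw := FiberBundle.mdifferentiableAt_extend I E w
  have := inner_leviCivitaFun g hX hY hw
  rw [h _ hw] at this
  simpa using this

/-- The Levi-Civita connection of `g`; `leviCivita g Y x v` is `∇_v Y`. It is torsion free and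
metric by the two theorems that follow. -/
def leviCivita : CovariantDerivative I E (fun p : M => TangentSpace I p) where
  toFun := leviCivitaFun g
  isCovariantDerivativeOnUniv :=
    { add := by
        intro Y Y' x hY hY' _
        ext1 v
        have hv := FiberBundle.mdifferentiableAt_extend I E v
        have key := leviCivita_eq g (X := FiberBundle.extend E v) (Y := Y + Y')
          (u := leviCivitaFun g Y x v + leviCivitaFun g Y' x v) hv
          (mdifferentiableAt_add_section hY hY') (fun Z hZ => by
            have a1 := inner_leviCivitaFun g hv hY hZ
            have a2 := inner_leviCivitaFun g hv hY' hZ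
            rw [FiberBundle.extend_apply_self] at a1 a2
            rw [map_add, add_apply, a1, a2]
            have e1 (Z : (p : M) → TangentSpace I p) :
                (fun p => g.inner p ((Y + Y') p) (Z p)) =
                (fun p => g.inner p (Y p) (Z p)) + (fun p => g.inner p (Y' p) (Z p)) := by
              ext p; simp
            have e2 (X : (p : M) → TangentSpace I p) :
                (fun p => g.inner p (X p) ((Y + Y') p)) =
                (fun p => g.inner p (X p) (Y p)) + (fun p => g.inner p (X p) (Y' p)) := by
              ext p; simp
            simp only [koszulForm, e1, e2,
              mvfderiv_add (metric_mdiffAt g hY hZ) (metric_mdiffAt g hY' hZ),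
              mvfderiv_add (metric_mdiffAt g hv hY) (metric_mdiffAt g hv hY'),
              mlieBracket_add_right hY hY', mlieBracket_add_left hY hY']
            simp
            ring)
        rw [FiberBundle.extend_apply_self] at key
        exact key
      leibniz := by
        intro Y f x hY hf _
        ext1 v
        have hv := FiberBundle.mdifferentiableAt_extend I E v
        have key := leviCivita_eq g (X := FiberBundle.extend E v) (Y := f • Y)
          (u := f x • leviCivitaFun g Y x v + (d% f x v) • Y x) hv
          (hf.smul_section hY) (fun Z hZ => by
            have a1 := inner_leviCivitaFun g hv hY hZ
            rw [FiberBundle.extend_apply_self] at a1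
            have e1 (Z : (p : M) → TangentSpace I p) :
                (fun p => g.inner p ((f • Y) p) (Z p)) =
                f * (fun p => g.inner p (Y p) (Z p)) := by
              ext p; simp
            have e2 (X : (p : M) → TangentSpace I p) :
                (fun p => g.inner p (X p) ((f • Y) p)) =
                f * (fun p => g.inner p (X p) (Y p)) := by
              ext p; simp
            rw [map_add, map_smul, map_smul, add_apply,
              smul_apply, smul_apply, a1]
            simp only [koszulForm, e1, e2, mvfderiv_mul hf (metric_mdiffAt g hY hZ),
              mvfderiv_mul hf (metric_mdiffAt g hv hY),
              mlieBracket_smul_right hf hY, mlieBracket_smul_left hf hY]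
            simp [g.symm x (Y x) v]
            ring)
        rw [FiberBundle.extend_apply_self] at key
        simpa using key }

theorem leviCivita_torsion : (leviCivita g).torsion = 0 := by
  rw [CovariantDerivative.torsion_eq_zero_iff]
  intro X Y x hX hY
  refine metric_ext g fun w => ?_
  have hw := FiberBundle.mdifferentiableAt_extend I E w
  have a1 := inner_leviCivitaFun g hX hY hw
  have a2 := inner_leviCivitaFun g hY hX hw
  rw [FiberBundle.extend_apply_self] at a1 a2
  change g.inner x (leviCivitaFun g Y x (X x) - leviCivitaFun g X x (Y x)) w = _
  rw [map_sub, sub_apply, a1, a2]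
  have e : (fun p => g.inner p (Y p) (X p)) = fun p => g.inner p (X p) (Y p) := by
    ext p; exact g.symm p _ _
  simp only [koszulForm, e, mlieBracket_swap_apply (I := I) (V := Y) (W := X)]
  simp
  ring

theorem leviCivita_metric {X Y Z : (p : M) → TangentSpace I p} {x : M}
    (hX : MDiffAt (T% X) x) (hY : MDiffAt (T% Y) x) (hZ : MDiffAt (T% Z) x) :
    d% (fun p => g.inner p (Y p) (Z p)) x (X x) =
      g.inner x (leviCivita g Y x (X x)) (Z x) + g.inner x (Y x) (leviCivita g Z x (X x)) := by
  have a1 := inner_leviCivitaFun g hX hY hZ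
  have a2 := inner_leviCivitaFun g hX hZ hY
  rw [g.symm x (Y x)]
  change _ = g.inner x (leviCivitaFun g Y x (X x)) (Z x) + g.inner x (leviCivitaFun g Z x (X x)) (Y x)
  rw [a1, a2]
  have e : (fun p => g.inner p (Z p) (Y p)) = fun p => g.inner p (Y p) (Z p) := by
    ext p; exact g.symm p _ _
  simp only [koszulForm, e, mlieBracket_swap_apply (I := I) (V := Z) (W := Y)]
  simp
  ring

end LeviCivita

/-- A codimension-one foliation of an `(n+1)`-manifold: a partition into connected sets (the leaves)
such that around every point there is a smooth chart, centred at this point, in which the connected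
components of the trace of each leaf are the slices on which the last coordinate is constant. -/
structure Foliation (n : ℕ) (M : Type*) [TopologicalSpace M]
    [ChartedSpace (EuclideanSpace ℝ (Fin (n + 1))) M] where
  leaves : Set (Set M)
  isConnected : ∀ L ∈ leaves, IsConnected L
  cover : ⋃₀ leaves = univ
  disjoint : ∀ L ∈ leaves, ∀ L' ∈ leaves, L ≠ L' → Disjoint L L'
  exists_chart : ∀ q : M, ∃ e ∈ IsManifold.maximalAtlas (𝓡 (n + 1)) ∞ M,
    q ∈ e.source ∧ e q = 0 ∧
      ∀ L ∈ leaves, ∀ x ∈ e.source ∩ L,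
        connectedComponentIn (e '' (e.source ∩ L)) (e x) =
          {y | y ∈ e.target ∧ y (Fin.last n) = e x (Fin.last n)}

section Defs

variable {n : ℕ} {M : Type*} [TopologicalSpace M]
  [ChartedSpace (EuclideanSpace ℝ (Fin (n + 1))) M]

/-- `v ∈ T_q M` is tangent to the leaf through `q`: it is the velocity at time `0` of a smooth
curve that starts at `q` and stays in one leaf. -/
def Foliation.IsTangent (F : Foliation n M) (q : M) (v : TangentSpace (𝓡 (n + 1)) q) : Prop :=
  ∃ L ∈ F.leaves, ∃ γ : ℝ → M, ContMDiffAt 𝓘(ℝ, ℝ) (𝓡 (n + 1)) ∞ γ 0 ∧ (∀ᶠ s in 𝓝 0, γ s ∈ L) ∧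
    tangentMap 𝓘(ℝ, ℝ) (𝓡 (n + 1)) γ ⟨0, (1 : ℝ)⟩ = ⟨q, v⟩

/-- Vector fields on `M`. -/
abbrev VField (n : ℕ) (M : Type*) [TopologicalSpace M]
    [ChartedSpace (EuclideanSpace ℝ (Fin (n + 1))) M] : Type _ :=
  (p : M) → TangentSpace (𝓡 (n + 1)) p

variable [IsManifold (𝓡 (n + 1)) ∞ M]

/-- Smooth vector fields. -/
def IsSmoothField (X : VField n M) : Prop :=
  ContMDiff (𝓡 (n + 1)) (𝓡 (n + 1)).tangent ∞
    (fun p => (⟨p, X p⟩ : TangentBundle (𝓡 (n + 1)) M))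

/-- A transverse orientation of `F`, given by a smooth vector field nowhere tangent to `F`
(the positive side). -/
structure IsTransverseOrientation (F : Foliation n M) (ν : VField n M) : Prop where
  smooth : IsSmoothField ν
  transverse : ∀ p, ¬ F.IsTangent p (ν p)

/-- Smooth Riemannian metrics on `M`. -/
abbrev RMetric (n : ℕ) (M : Type*) [TopologicalSpace M]
    [ChartedSpace (EuclideanSpace ℝ (Fin (n + 1))) M] [IsManifold (𝓡 (n + 1)) ∞ M] : Type _ :=
  ContMDiffRiemannianMetric (𝓡 (n + 1)) ∞ (EuclideanSpace ℝ (Fin (n + 1)))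
    (fun p : M => TangentSpace (𝓡 (n + 1)) p)

/-- `N` is the `g`-unit normal vector field of `F` that is positive for the transverse
orientation `ν`. -/
structure IsUnitNormal (F : Foliation n M) (ν : VField n M) (g : RMetric n M) (N : VField n M) :
    Prop where
  smooth : IsSmoothField N
  unit : ∀ p, g.inner p (N p) (N p) = 1
  normal : ∀ p v, F.IsTangent p v → g.inner p (N p) v = 0
  pos : ∀ p, 0 < g.inner p (N p) (ν p)

/-- The component `v ↦ v - g(N, v) N` of a vector tangent to the foliation with unit normal `N`. -/
def tangentialPart (g : RMetric n M) (N : VField n M) (p : M) :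
    TangentSpace (𝓡 (n + 1)) p →L[ℝ] TangentSpace (𝓡 (n + 1)) p :=
  ContinuousLinearMap.id ℝ _ - (g.inner p (N p)).smulRight (N p)

/-- The Weingarten operator `A X = -∇_X N` for `X` tangent to the leaves, extended by `A N = 0`. -/
def weingarten (g : RMetric n M) (N : VField n M) (p : M) :
    TangentSpace (𝓡 (n + 1)) p →L[ℝ] TangentSpace (𝓡 (n + 1)) p :=
  -((leviCivita g N p).comp (tangentialPart g N p))

/-- The truncated symmetric tensor `b̂_j` dual to the `j`-th power of the Weingarten operator;
in particular `b̂_0` is the truncated metric. -/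
def bHat (g : RMetric n M) (N : VField n M) (j : ℕ) (p : M) (v w : TangentSpace (𝓡 (n + 1)) p) :
    ℝ :=
  g.inner p ((weingarten g N p ^ j) (tangentialPart g N p v)) (tangentialPart g N p w)

/-- The power sum `τ_i` of the principal curvatures: the trace of the `i`-th power of the
Weingarten operator on the tangent spaces of the leaves. (The composition with the projection onto
the tangent space of the leaf matters for `i = 0` only, where the value is `n`.) -/
def powerSum (g : RMetric n M) (N : VField n M) (i : ℕ) (p : M) : ℝ :=
  LinearMap.trace ℝ (TangentSpace (𝓡 (n + 1)) p)
    ((weingarten g N p ^ i).comp (tangentialPart g N p)).toLinearMap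

/-- `g t`, `0 ≤ t < ε`, with positive unit normals `N t`, is a (smooth) extrinsic geometric flow
with coefficient functions `f j`, `0 ≤ j < n`: `∂_t g_t = ∑_{j<n} f_j b̂_j^t`. -/
structure IsEGF (F : Foliation n M) (ν : VField n M) (f : ℕ → M → ℝ → ℝ) (ε : ℝ)
    (g : ℝ → RMetric n M) (N : ℝ → VField n M) : Prop where
  smooth : ContMDiffOn ((𝓡 (n + 1)).prod 𝓘(ℝ, ℝ))
    ((𝓡 (n + 1)).prod 𝓘(ℝ, EuclideanSpace ℝ (Fin (n + 1)) →L[ℝ]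
      EuclideanSpace ℝ (Fin (n + 1)) →L[ℝ] ℝ)) ∞
    (fun z : M × ℝ => TotalSpace.mk' (EuclideanSpace ℝ (Fin (n + 1)) →L[ℝ]
      EuclideanSpace ℝ (Fin (n + 1)) →L[ℝ] ℝ)
      (E := fun p : M => TangentSpace (𝓡 (n + 1)) p →L[ℝ] TangentSpace (𝓡 (n + 1)) p →L[ℝ] ℝ)
      z.1 ((g z.2).inner z.1))
    (univ ×ˢ Ico 0 ε)
  isUnitNormal : ∀ t ∈ Ico 0 ε, IsUnitNormal F ν (g t) (N t)
  evolution : ∀ t ∈ Ico 0 ε, ∀ (p : M) (v w : TangentSpace (𝓡 (n + 1)) p),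
    HasDerivWithinAt (fun s => (g s).inner p v w)
      (∑ j ∈ Finset.range n, f j p t * bHat (g t) (N t) j p v w) (Ico 0 ε) t

end Defs

section Flow

/-- A vector field is complete if every point lies on an integral curve defined on all of `ℝ`. -/
def IsCompleteField {E H M : Type*} [NormedAddCommGroup E] [NormedSpace ℝ E] [TopologicalSpace H]
    {I : ModelWithCorners ℝ E H} [TopologicalSpace M] [ChartedSpace H M]
    (X : (p : M) → TangentSpace I p) : Prop :=
  ∀ p : M, ∃ γ : ℝ → M, γ 0 = p ∧ IsMIntegralCurve γ X

/-- `φ` is the (global) flow of `X`: each orbit `t ↦ φ t z` is the integral curve of `X`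
starting at `z`. -/
structure IsFlow {E H M : Type*} [NormedAddCommGroup E] [NormedSpace ℝ E] [TopologicalSpace H]
    {I : ModelWithCorners ℝ E H} [TopologicalSpace M] [ChartedSpace H M]
    (X : (p : M) → TangentSpace I p) (φ : ℝ → M → M) : Prop where
  zero : ∀ z, φ 0 z = z
  orbit : ∀ z, IsMIntegralCurve (fun t => φ t z) X

variable {n : ℕ} {M : Type*} [TopologicalSpace M]
  [ChartedSpace (EuclideanSpace ℝ (Fin (n + 1))) M]

/-- The vector field `∂_t + (C/2) N` on `M × ℝ`. -/
def spaceTimeField (C : ℝ) (N : VField n M) :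
    (z : M × ℝ) → TangentSpace ((𝓡 (n + 1)).prod 𝓘(ℝ, ℝ)) z :=
  fun z => ((C / 2) • N z.1, (1 : ℝ))

end Flow

end EGF

end

/-! Let `θ = g(N, ·)`, let `G = g - θ ⊗ θ` be the truncated metric and `B = g(A ·, ·)` the second
fundamental form. The tangent hyperplanes of the leaves are fixed and `∂_t g` vanishes on `N`, so
the unit normal `N` does not depend on `t`. The flow becomes `∂_t G = C B`, while the Koszul formula
gives `L_N G = -2 B`: hence `G` is invariant under `X = ∂_t + (C/2) N`. Since `N` is independent of
`t`, the derivations `∂_t` and `L_N` commute, so `X` annihilates `B` too when `C ≠ 0`. As `B = G A`,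
the derivative of `A` along `X` is a commutator plus a term with values in `ℝ N` vanishing on `N`.
Both are invisible to the traces of the powers of `A`, which are therefore constant along the orbits
of `X`. -/

noncomputable section

namespace EGF

open Bundle Set Filter Topology VectorField

-- Shortcuts, without which instance search on spaces of bilinear forms times out.
local instance instNormedAddCommGroupForm {E : Type*} [NormedAddCommGroup E] [NormedSpace ℝ E] :
    NormedAddCommGroup (E →L[ℝ] ℝ) :=
  ContinuousLinearMap.toNormedAddCommGroup

local instance instNormedSpaceForm {E : Type*} [NormedAddCommGroup E] [NormedSpace ℝ E] :
    NormedSpace ℝ (E →L[ℝ] ℝ) :=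
  ContinuousLinearMap.toNormedSpace

local instance instNormedAddCommGroupBilinForm {E : Type*} [NormedAddCommGroup E]
    [NormedSpace ℝ E] : NormedAddCommGroup (E →L[ℝ] E →L[ℝ] ℝ) :=
  ContinuousLinearMap.toNormedAddCommGroup

section TracePowers

variable {E : Type*} [NormedAddCommGroup E] [NormedSpace ℝ E]

section Trace

variable [FiniteDimensional ℝ E]

/-- The trace of a continuous endomorphism of a finite-dimensional space, as a continuous linear
functional, so that it can be differentiated along curves of endomorphisms. -/
def traceCLM (E : Type*) [NormedAddCommGroup E] [NormedSpace ℝ E] [FiniteDimensional ℝ E] :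
    (E →L[ℝ] E) →L[ℝ] ℝ :=
  LinearMap.toContinuousLinearMap
    ((LinearMap.trace ℝ E).comp (ContinuousLinearMap.coeLM ℝ))

theorem traceCLM_smulRight (η : E →L[ℝ] ℝ) (n : E) : traceCLM E (η.smulRight n) = η n :=
  LinearMap.trace_smulRight η.toLinearMap n

theorem traceCLM_mul_comm (S T : E →L[ℝ] E) : traceCLM E (S * T) = traceCLM E (T * S) :=
  LinearMap.trace_mul_comm ℝ S.toLinearMap T.toLinearMap

theorem hasDerivAt_traceCLM_pow_succ {A : ℝ → E →L[ℝ] E} {A' : E →L[ℝ] E} {s : ℝ}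
    (hA : HasDerivAt A A' s) (i : ℕ) :
    HasDerivAt (fun r => traceCLM E (A r ^ (i + 1))) ((i + 1) * traceCLM E (A s ^ i * A')) s := by
  convert! (traceCLM E).hasFDerivAt.comp_hasDerivAt s (hA.fun_pow' (i + 1)) using 1
  have hterm : ∀ j ∈ Finset.range (i + 1),
      traceCLM E (A s ^ (i - j) * A' * A s ^ j) = traceCLM E (A s ^ i * A') := fun j hj => by
    rw [traceCLM_mul_comm, ← mul_assoc, ← pow_add,
      Nat.add_sub_cancel' (Finset.mem_range_succ_iff.1 hj)]
  simp [map_sum, Finset.sum_congr rfl hterm]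

theorem traceCLM_pow_mul_commutator_add_smulRight {A K : E →L[ℝ] E} {η : E →L[ℝ] ℝ} {n : E}
    (hn : A n = 0) (hη : η n = 0) (i : ℕ) :
    traceCLM E (A ^ i * (K * A - A * K + η.smulRight n)) = 0 := by
  have hrank : A ^ i * η.smulRight n = η.smulRight ((A ^ i) n) := by
    ext u; simp
  have hηn : η ((A ^ i) n) = 0 := by
    cases i with
    | zero => simpa using hη
    | succ i => simp [pow_succ, hn]
  have hcomm : traceCLM E (A ^ i * (K * A)) = traceCLM E (A ^ i * (A * K)) := by
    rw [← mul_assoc, traceCLM_mul_comm, ← mul_assoc, ← mul_assoc, pow_mul_comm']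
  rw [mul_add, mul_sub, hrank, map_add, map_sub, hcomm, sub_self, traceCLM_smulRight, hηn, add_zero]

end Trace

/-- The action `β ↦ β(D ·, ·) + β(·, D ·)` of an endomorphism `D` on bilinear forms: the term of
order zero in the Lie derivative of a bilinear form along a vector field with derivative `D`. -/
def bilinAction (D : E →L[ℝ] E) : (E →L[ℝ] E →L[ℝ] ℝ) →L[ℝ] (E →L[ℝ] E →L[ℝ] ℝ) :=
  (ContinuousLinearMap.compL ℝ E E (E →L[ℝ] ℝ)).flip D
    + ContinuousLinearMap.compL ℝ E (E →L[ℝ] ℝ) (E →L[ℝ] ℝ)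
        ((ContinuousLinearMap.compL ℝ E E ℝ).flip D)

theorem bilinAction_apply (D : E →L[ℝ] E) (β : E →L[ℝ] E →L[ℝ] ℝ) (u v : E) :
    bilinAction D β u v = β (D u) v + β u (D v) := by
  simp [bilinAction]

theorem bilinAction_smul (c : ℝ) (D : E →L[ℝ] E) (β : E →L[ℝ] E →L[ℝ] ℝ) :
    bilinAction (c • D) β = c • bilinAction D β := by
  ext u v
  simp [bilinAction_apply, mul_add]

section Transport

variable {G B : ℝ → E →L[ℝ] E →L[ℝ] ℝ} {A : ℝ → E →L[ℝ] E} {n : ℝ → E} {A' K : E →L[ℝ] E} {s : ℝ}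

theorem comp_deriv_eq_comp_commutator (hG : HasDerivAt G (-bilinAction K (G s)) s)
    (hB : HasDerivAt B (-bilinAction K (B s)) s) (hA : HasDerivAt A A' s)
    (hGA : ∀ᶠ r in 𝓝 s, (G r).comp (A r) = B r) :
    (G s).comp A' = (G s).comp (K * A s - A s * K) := by
  have hGA' : (-bilinAction K (G s)).comp (A s) + (G s).comp A' = -bilinAction K (B s) := by
    refine HasDerivAt.unique (f := B) ?_ hB
    exact (hG.clm_comp hA).congr_of_eventuallyEq (EventuallyEq.symm hGA)
  rw [← hGA.self_of_nhds] at hGA'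
  ext u v
  have huv := congr($hGA' u v)
  simp only [add_apply, neg_apply, ContinuousLinearMap.comp_apply, bilinAction_apply, sub_apply,
    mul_apply_eq_comp, map_sub] at huv ⊢
  linarith

theorem exists_deriv_eq_commutator_add_smulRight (hG : HasDerivAt G (-bilinAction K (G s)) s)
    (hB : HasDerivAt B (-bilinAction K (B s)) s) (hA : HasDerivAt A A' s)
    (hn : HasDerivAt n (K (n s)) s) (hGA : ∀ᶠ r in 𝓝 s, (G r).comp (A r) = B r)
    (hAn : ∀ᶠ r in 𝓝 s, A r (n r) = 0) {θ : E →L[ℝ] ℝ}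
    (hker : ∀ w, G s w = 0 → w = θ w • n s) :
    ∃ η : E →L[ℝ] ℝ, A' = K * A s - A s * K + η.smulRight (n s) ∧ η (n s) = 0 := by
  have hcomp := comp_deriv_eq_comp_commutator hG hB hA hGA
  have hdiff (u : E) : G s ((A' - (K * A s - A s * K)) u) = 0 := by
    simpa [sub_eq_zero] using congr($hcomp u)
  have hAn' : A' (n s) + A s (K (n s)) = 0 :=
    (hA.clm_apply hn).unique ((hasDerivAt_const s (0 : E)).congr_of_eventuallyEq hAn)
  have hdiffn : (A' - (K * A s - A s * K)) (n s) = 0 := by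
    simpa [hAn.self_of_nhds, sub_eq_add_neg] using hAn'
  refine ⟨θ.comp (A' - (K * A s - A s * K)), sub_eq_iff_eq_add'.1 ?_, ?_⟩
  · ext1 u
    exact hker _ (hdiff u)
  · rw [ContinuousLinearMap.comp_apply, hdiffn, map_zero]

theorem hasDerivAt_traceCLM_pow_of_transport [FiniteDimensional ℝ E]
    (hG : HasDerivAt G (-bilinAction K (G s)) s) (hB : HasDerivAt B (-bilinAction K (B s)) s)
    (hA : DifferentiableAt ℝ A s) (hn : HasDerivAt n (K (n s)) s)
    (hGA : ∀ᶠ r in 𝓝 s, (G r).comp (A r) = B r) (hAn : ∀ᶠ r in 𝓝 s, A r (n r) = 0)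
    {θ : E →L[ℝ] ℝ} (hker : ∀ w, G s w = 0 → w = θ w • n s) (i : ℕ) :
    HasDerivAt (fun r => traceCLM E (A r ^ (i + 1))) 0 s := by
  obtain ⟨η, hA', hη⟩ :=
    exists_deriv_eq_commutator_add_smulRight hG hB hA.hasDerivAt hn hGA hAn hker
  simpa only [hA', traceCLM_pow_mul_commutator_add_smulRight hAn.self_of_nhds hη, mul_zero]
    using hasDerivAt_traceCLM_pow_succ hA.hasDerivAt i

end Transport

end TracePowers

section LieDerivative

variable {E : Type*} [NormedAddCommGroup E] [NormedSpace ℝ E]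

/-- The Lie derivative at `x` of a field `β` of bilinear forms on a vector space along the vector
field `N`, expressed through the flat derivative. -/
def lieDerivBilin (N : E → E) (β : E → E →L[ℝ] E →L[ℝ] ℝ) (x : E) : E →L[ℝ] E →L[ℝ] ℝ :=
  fderiv ℝ β x (N x) + bilinAction (fderiv ℝ N x) (β x)

/-- The bilinear form `β - β(n, ·) ⊗ β(n, ·)`; for a symmetric `β` with `β(n, n) = 1` it is the
restriction of `β` to the orthogonal complement of `n`, extended by `0`. -/
def truncate (β : E →L[ℝ] E →L[ℝ] ℝ) (n : E) : E →L[ℝ] E →L[ℝ] ℝ :=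
  β - (β n).smulRight (β n)

theorem truncate_apply (β : E →L[ℝ] E →L[ℝ] ℝ) (n u v : E) :
    truncate β n u v = β u v - β n u * β n v := by
  simp [truncate]

theorem truncate_apply_self {β : E →L[ℝ] E →L[ℝ] ℝ} {n : E} (hn : β n n = 1) :
    truncate β n n = 0 := by
  ext v
  simp [truncate_apply, hn]

theorem truncate_symm {β : E →L[ℝ] E →L[ℝ] ℝ} (hβ : ∀ u v, β u v = β v u) (n u v : E) :
    truncate β n u v = truncate β n v u := by
  rw [truncate_apply, truncate_apply, hβ u v, mul_comm]

theorem bilin_ext_of_ker {b b' : E →L[ℝ] E →L[ℝ] ℝ} {n : E} {θ : E →L[ℝ] ℝ} (hθ : θ n = 1)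
    (hbn : b n = 0) (hbn' : b' n = 0) (hb : ∀ u v, b u v = b v u) (hb' : ∀ u v, b' u v = b' v u)
    (h : ∀ u v, θ u = 0 → θ v = 0 → b u v = b' u v) : b = b' := by
  ext u v
  have hker (w : E) : θ (w - θ w • n) = 0 := by simp [hθ]
  simpa [hbn, hbn', hb _ n, hb' _ n] using h _ _ (hker u) (hker v)

variable {N : E → E} {β g : E → E →L[ℝ] E →L[ℝ] ℝ} {x : E}

theorem hasFDerivAt_bilin_apply {F : Type*} [NormedAddCommGroup F] [NormedSpace ℝ F]
    {β : F → E →L[ℝ] E →L[ℝ] ℝ} {β' : F →L[ℝ] E →L[ℝ] E →L[ℝ] ℝ} {x : F}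
    (hβ : HasFDerivAt β β' x) (u v : E) :
    HasFDerivAt (fun y => β y u v) ((β'.flip u).flip v) x := by
  convert! (hβ.clm_apply (hasFDerivAt_const u x)).clm_apply (hasFDerivAt_const v x) using 1
  ext w
  simp

theorem differentiableAt_truncate (hg : DifferentiableAt ℝ g x) (hN : DifferentiableAt ℝ N x) :
    DifferentiableAt ℝ (fun y => truncate (g y) (N y)) x := by
  unfold truncate
  fun_prop

theorem lieDerivBilin_apply_self (hβ : DifferentiableAt ℝ β x) (hN : DifferentiableAt ℝ N x)
    (h : ∀ᶠ y in 𝓝 x, β y (N y) = 0) : lieDerivBilin N β x (N x) = 0 := by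
  have hzero := congr($((hβ.hasFDerivAt.clm_apply hN.hasFDerivAt).unique
    ((hasFDerivAt_const 0 x).congr_of_eventuallyEq h)) (N x))
  ext v
  simpa [lieDerivBilin, bilinAction_apply, h.self_of_nhds, add_comm] using congr($hzero v)

theorem lieDerivBilin_symm (hβ : DifferentiableAt ℝ β x)
    (h : ∀ᶠ y in 𝓝 x, ∀ u v, β y u v = β y v u) (u v : E) :
    lieDerivBilin N β x u v = lieDerivBilin N β x v u := by
  have hderiv := congr($((hasFDerivAt_bilin_apply hβ.hasFDerivAt u v).unique
    ((hasFDerivAt_bilin_apply hβ.hasFDerivAt v u).congr_of_eventuallyEq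
      (h.mono fun y hy => hy u v))) (N x))
  simp only [ContinuousLinearMap.flip_apply] at hderiv
  simp only [lieDerivBilin, add_apply, bilinAction_apply, hderiv]
  rw [h.self_of_nhds u, h.self_of_nhds _ v]
  ring

theorem fderiv_truncate_apply_of_orthogonal (hg : DifferentiableAt ℝ g x)
    (hN : DifferentiableAt ℝ N x) {u v : E} (hu : g x (N x) u = 0) (hv : g x (N x) v = 0) (w : E) :
    fderiv ℝ (fun y => truncate (g y) (N y)) x w u v = fderiv ℝ g x w u v := by
  have hθ : DifferentiableAt ℝ (fun y => g y (N y)) x := hg.clm_apply hN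
  have hT : DifferentiableAt ℝ (fun y => truncate (g y) (N y)) x := differentiableAt_truncate hg hN
  have hθ_apply (u : E) := hθ.hasFDerivAt.clm_apply (hasFDerivAt_const u x)
  have h := (hasFDerivAt_bilin_apply hg.hasFDerivAt u v).sub ((hθ_apply u).mul (hθ_apply v))
  have huniq := (hasFDerivAt_bilin_apply hT.hasFDerivAt u v).unique
    (h.congr_of_eventuallyEq (.of_forall fun y => truncate_apply _ _ u v))
  simpa [hu, hv] using congr($huniq w)

theorem eq_neg_half_smul_lieDerivBilin_truncate {b : E →L[ℝ] E →L[ℝ] ℝ}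
    (hg : DifferentiableAt ℝ g x) (hN : DifferentiableAt ℝ N x)
    (hsymm : ∀ᶠ y in 𝓝 x, ∀ u v, g y u v = g y v u) (hunit : ∀ᶠ y in 𝓝 x, g y (N y) (N y) = 1)
    (hbN : b (N x) = 0) (hb : ∀ u v, b u v = b v u)
    (hkoszul : ∀ u v, g x (N x) u = 0 → g x (N x) v = 0 → 2 * b u v = -lieDerivBilin N g x u v) :
    b = -(1 / 2 : ℝ) • lieDerivBilin N (fun y => truncate (g y) (N y)) x := by
  have hT : DifferentiableAt ℝ (fun y => truncate (g y) (N y)) x := differentiableAt_truncate hg hN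
  have hLN : lieDerivBilin N (fun y => truncate (g y) (N y)) x (N x) = 0 :=
    lieDerivBilin_apply_self hT hN (hunit.mono fun y => truncate_apply_self)
  have hLsymm := lieDerivBilin_symm (N := N) hT (hsymm.mono fun y hy => truncate_symm hy (N y))
  refine bilin_ext_of_ker hunit.self_of_nhds hbN (by simp [hLN]) hb
    (fun u v => by simp [hLsymm u v]) fun u v hu hv => ?_
  have hbuv := hkoszul u v hu hv
  simp only [lieDerivBilin, add_apply, bilinAction_apply] at hbuv
  simp only [lieDerivBilin, smul_apply, add_apply, bilinAction_apply, smul_eq_mul,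
    fderiv_truncate_apply_of_orthogonal hg hN hu hv, truncate_apply, hu, hv]
  linarith

end LieDerivative

section LieTransport

variable {E F : Type*} [NormedAddCommGroup E] [NormedSpace ℝ E] [NormedAddCommGroup F]
  [NormedSpace ℝ F]

theorem fderiv_fderiv_apply_of_fderiv_apply_eq {G B : E → F} {x w : E} {C : ℝ}
    (hG : ContDiffAt ℝ 2 G x) (hB : DifferentiableAt ℝ B x)
    (hw : ∀ᶠ y in 𝓝 x, fderiv ℝ G y w = C • B y) (u : E) :
    fderiv ℝ (fderiv ℝ G) x w u = C • fderiv ℝ B x u := by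
  have hdG : DifferentiableAt ℝ (fderiv ℝ G) x :=
    (hG.fderiv_right (m := 1) (by norm_num)).differentiableAt (by simp)
  have huniq := (hdG.hasFDerivAt.clm_apply (hasFDerivAt_const w x)).unique
    ((hB.hasFDerivAt.const_smul C).congr_of_eventuallyEq hw)
  rw [hG.isSymmSndFDerivAt (by simp) w u]
  simpa using congr($huniq u)

variable {G B : E × ℝ → F} {N : E → E} {R : E → F →L[ℝ] F} {C : ℝ} {p : E × ℝ}

theorem fderiv_time_of_lieDeriv (hG : ContDiffAt ℝ 2 G p) (hB : DifferentiableAt ℝ B p)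
    (hspace : ∀ᶠ z in 𝓝 p, B z = -(1 / 2 : ℝ) • (fderiv ℝ G z (N z.1, 0) + R z.1 (G z)))
    (htime : ∀ᶠ z in 𝓝 p, fderiv ℝ G z (0, 1) = C • B z) :
    fderiv ℝ B p (0, 1) = -(C / 2) • (fderiv ℝ B p (N p.1, 0) + R p.1 (B p)) := by
  have hcurve : HasDerivAt (fun s : ℝ => (p.1, s)) (0, 1) p.2 :=
    (hasDerivAt_const _ _).prodMk (hasDerivAt_id _)
  have hdG : DifferentiableAt ℝ (fderiv ℝ G) p :=
    (hG.fderiv_right (m := 1) (by norm_num)).differentiableAt (by simp)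
  have hBt : HasDerivAt (fun s => B (p.1, s)) (fderiv ℝ B p (0, 1)) p.2 :=
    hB.hasFDerivAt.comp_hasDerivAt_of_eq p.2 hcurve rfl
  have hGt : HasDerivAt (fun s => G (p.1, s)) (C • B p) p.2 := htime.self_of_nhds ▸
    (hG.differentiableAt (by simp)).hasFDerivAt.comp_hasDerivAt_of_eq p.2 hcurve rfl
  have hdGt : HasDerivAt (fun s => fderiv ℝ G (p.1, s) (N p.1, 0))
      (C • fderiv ℝ B p (N p.1, 0)) p.2 := by
    rw [← fderiv_fderiv_apply_of_fderiv_apply_eq hG hB htime]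
    simpa using (hdG.hasFDerivAt.comp_hasDerivAt_of_eq p.2 hcurve rfl).clm_apply
      (hasDerivAt_const p.2 ((N p.1, 0) : E × ℝ))
  have hRt := (R p.1).hasFDerivAt.comp_hasDerivAt p.2 hGt
  rw [hBt.unique (((hdGt.add hRt).const_smul (-(1 / 2) : ℝ)).congr_of_eventuallyEq
    (hcurve.continuousAt.eventually hspace)), map_smul]
  module

theorem hasDerivAt_of_lieTransport (hG : ContDiffAt ℝ 2 G p) (hB : DifferentiableAt ℝ B p)
    (hspace : ∀ᶠ z in 𝓝 p, B z = -(1 / 2 : ℝ) • (fderiv ℝ G z (N z.1, 0) + R z.1 (G z)))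
    (htime : ∀ᶠ z in 𝓝 p, fderiv ℝ G z (0, 1) = C • B z)
    {z : ℝ → E × ℝ} {s : ℝ} (hzs : p = z s) (hz : HasDerivAt z ((C / 2) • N p.1, 1) s) :
    HasDerivAt (fun r => G (z r)) (-(C / 2) • R p.1 (G p)) s ∧
      HasDerivAt (fun r => B (z r)) (-(C / 2) • R p.1 (B p)) s := by
  have hsplit : (((C / 2) • N p.1, 1) : E × ℝ) = (C / 2) • (N p.1, 0) + (0, 1) := by simp
  constructor
  · convert! (hG.differentiableAt (by simp)).hasFDerivAt.comp_hasDerivAt_of_eq s hz hzs using 1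
    rw [hsplit, map_add, map_smul, htime.self_of_nhds, hspace.self_of_nhds]
    module
  · convert! hB.hasFDerivAt.comp_hasDerivAt_of_eq s hz hzs using 1
    rw [hsplit, map_add, map_smul, fderiv_time_of_lieDeriv hG hB hspace htime]
    module

end LieTransport

section LocalFlow

variable {E : Type*} [NormedAddCommGroup E] [NormedSpace ℝ E]

theorem hasFDerivAt_comp_prodMk_left {F : Type*} [NormedAddCommGroup F] [NormedSpace ℝ F]
    {U : Set E} {S : Set ℝ} (hU : IsOpen U) {f : E × ℝ → F} {z : E × ℝ} (hz : z ∈ U ×ˢ S)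
    (hf : DifferentiableWithinAt ℝ f (U ×ˢ S) z) :
    HasFDerivAt (fun y => f (y, z.2))
      ((fderivWithin ℝ f (U ×ˢ S) z).comp (ContinuousLinearMap.inl ℝ E ℝ)) z.1 := by
  have hincl : HasFDerivWithinAt (fun y : E => (y, z.2)) (ContinuousLinearMap.inl ℝ E ℝ) U z.1 :=
    (hasFDerivAt_prodMk_left z.1 z.2).hasFDerivWithinAt
  have hmaps : MapsTo (fun y : E => (y, z.2)) U (U ×ˢ S) := fun y hy => ⟨hy, hz.2⟩
  exact (hf.hasFDerivWithinAt.comp z.1 hincl hmaps).hasFDerivAt (hU.mem_nhds hz.1)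

theorem isInvertible_of_pos [FiniteDimensional ℝ E] {β : E →L[ℝ] E →L[ℝ] ℝ}
    (hβ : ∀ u ≠ 0, 0 < β u u) : β.IsInvertible := by
  have hinj : Function.Injective β.toLinearMap := by
    rw [injective_iff_map_eq_zero]
    intro v hv
    by_contra hne
    exact (hβ v hne).ne' congr(($hv : E →L[ℝ] ℝ) v)
  have hdim : Module.finrank ℝ E = Module.finrank ℝ (E →L[ℝ] ℝ) :=
    Subspace.dual_finrank_eq.symm.trans LinearMap.toContinuousLinearMap.finrank_eq
  exact ⟨(LinearEquiv.ofInjectiveOfFinrankEq β.toLinearMap hinj hdim).toContinuousLinearEquiv, rfl⟩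

theorem eq_smul_of_truncate_eq_zero {β : E →L[ℝ] E →L[ℝ] ℝ} (hβ : ∀ u ≠ 0, 0 < β u u) {n w : E}
    (hw : truncate β n w = 0) : w = β n w • n := by
  by_contra hne
  have hpos := hβ _ (sub_ne_zero.2 hne)
  have hzero := congr($hw (w - β n w • n))
  rw [truncate_apply] at hzero
  simp only [map_sub, map_smul, sub_apply, smul_apply, smul_eq_mul, zero_apply] at hpos hzero
  linarith

/-- A flow `∂_t g = C g(A ·, ·)` on an open set of a vector space, with a unit vector field `N`
independent of time. The field `koszul` encodes that `A` is the Weingarten operator of `N`: on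
vectors orthogonal to `N`, the symmetric part of `-2 g(A ·, ·)` is the Lie derivative of `g` along
`N`. The symmetry of `g(A ·, ·)`, for leaves of a foliation a consequence of integrability, comes
here from that of `∂_t g`. -/
structure IsLocalFlow (U : Set E) (ε C : ℝ) (g : E × ℝ → E →L[ℝ] E →L[ℝ] ℝ) (N : E → E)
    (A : E × ℝ → E →L[ℝ] E) : Prop where
  isOpen : IsOpen U
  contDiffOn_metric : ContDiffOn ℝ ∞ g (U ×ˢ Ico 0 ε)
  contDiffOn_normal : ContDiffOn ℝ ∞ N U
  symm : ∀ z ∈ U ×ˢ Ico 0 ε, ∀ u v, g z u v = g z v u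
  pos : ∀ z ∈ U ×ˢ Ico 0 ε, ∀ u ≠ 0, 0 < g z u u
  unit : ∀ z ∈ U ×ˢ Ico 0 ε, g z (N z.1) (N z.1) = 1
  evolution : ∀ z ∈ U ×ˢ Ico 0 ε, ∀ u v,
    HasDerivWithinAt (fun s => g (z.1, s) u v) (C * g z (A z u) v) (Ico 0 ε) z.2
  apply_normal : ∀ z ∈ U ×ˢ Ico 0 ε, A z (N z.1) = 0
  koszul : ∀ z ∈ U ×ˢ Ico 0 ε, ∀ u v, g z (N z.1) u = 0 → g z (N z.1) v = 0 →
    g z (A z u) v + g z (A z v) u = -lieDerivBilin N (fun y => g (y, z.2)) z.1 u v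

namespace IsLocalFlow

variable {U : Set E} {ε C : ℝ} {g : E × ℝ → E →L[ℝ] E →L[ℝ] ℝ} {N : E → E} {A : E × ℝ → E →L[ℝ] E}
  {z : E × ℝ}

theorem uniqueDiffOn (h : IsLocalFlow U ε C g N A) : UniqueDiffOn ℝ (U ×ˢ Ico 0 ε) :=
  h.isOpen.uniqueDiffOn.prod (uniqueDiffOn_Ico 0 ε)

theorem mem_nhds (h : IsLocalFlow U ε C g N A) (hz : z ∈ U ×ˢ Ioo 0 ε) : U ×ˢ Ico 0 ε ∈ 𝓝 z :=
  prod_mem_nhds (h.isOpen.mem_nhds hz.1) (Ico_mem_nhds hz.2.1 hz.2.2)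

theorem differentiableAt_normal (h : IsLocalFlow U ε C g N A) (hz : z ∈ U ×ˢ Ico 0 ε) :
    DifferentiableAt ℝ N z.1 :=
  (h.contDiffOn_normal.contDiffAt (h.isOpen.mem_nhds hz.1)).differentiableAt (by simp)

theorem contDiffOn_normal_comp (h : IsLocalFlow U ε C g N A) :
    ContDiffOn ℝ ∞ (fun z : E × ℝ => N z.1) (U ×ˢ Ico 0 ε) :=
  h.contDiffOn_normal.comp contDiffOn_fst fun _ hz => hz.1

theorem contDiffOn_truncate (h : IsLocalFlow U ε C g N A) :
    ContDiffOn ℝ ∞ (fun z => truncate (g z) (N z.1)) (U ×ˢ Ico 0 ε) := by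
  have hθ := h.contDiffOn_metric.clm_apply h.contDiffOn_normal_comp
  exact h.contDiffOn_metric.sub (hθ.smulRight hθ)

theorem secondForm_symm (h : IsLocalFlow U ε C g N A) (hC : C ≠ 0) (hz : z ∈ U ×ˢ Ico 0 ε)
    (u v : E) : g z (A z u) v = g z (A z v) u := by
  have huv := h.evolution z hz u v
  have hvu := (h.evolution z hz v u).congr (fun s hs => h.symm (z.1, s) ⟨hz.1, hs⟩ u v)
    (h.symm (z.1, z.2) hz u v)
  exact mul_left_cancel₀ hC (UniqueDiffWithinAt.eq_deriv _ (uniqueDiffOn_Ico 0 ε _ hz.2) huv hvu)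

theorem truncate_comp_weingarten (h : IsLocalFlow U ε C g N A) (hC : C ≠ 0)
    (hz : z ∈ U ×ˢ Ico 0 ε) :
    (truncate (g z) (N z.1)).comp (A z) = (g z).comp (A z) := by
  ext u v
  have horth : g z (N z.1) (A z u) = 0 := by
    rw [h.symm z hz, h.secondForm_symm hC hz, h.apply_normal z hz, map_zero, zero_apply]
  simp [truncate_apply, horth]

theorem secondForm_eq (h : IsLocalFlow U ε C g N A) (hC : C ≠ 0) (hz : z ∈ U ×ˢ Ico 0 ε) :
    (g z).comp (A z) = -(1 / 2 : ℝ) •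
      (fderivWithin ℝ (fun z => truncate (g z) (N z.1)) (U ×ˢ Ico 0 ε) z (N z.1, 0)
        + bilinAction (fderiv ℝ N z.1) (truncate (g z) (N z.1))) := by
  have hU := h.isOpen.mem_nhds hz.1
  have hg : DifferentiableAt ℝ (fun y => g (y, z.2)) z.1 :=
    (hasFDerivAt_comp_prodMk_left h.isOpen hz
      (h.contDiffOn_metric.differentiableOn (by simp) z hz)).differentiableAt
  have hlie := eq_neg_half_smul_lieDerivBilin_truncate (b := (g z).comp (A z)) hg
    (h.differentiableAt_normal hz)
    (eventually_of_mem hU fun y hy => h.symm (y, z.2) ⟨hy, hz.2⟩)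
    (eventually_of_mem hU fun y hy => h.unit (y, z.2) ⟨hy, hz.2⟩)
    (by simp [h.apply_normal z hz]) (h.secondForm_symm hC hz)
    (fun u v hu hv => by
      rw [← h.koszul z hz u v hu hv, h.secondForm_symm hC hz v u, ← two_mul]
      rfl)
  have htrunc := hasFDerivAt_comp_prodMk_left h.isOpen hz
    (h.contDiffOn_truncate.differentiableOn (by simp) z hz)
  rwa [lieDerivBilin, htrunc.fderiv] at hlie

theorem contDiffOn_secondForm (h : IsLocalFlow U ε C g N A) (hC : C ≠ 0) :
    ContDiffOn ℝ ∞ (fun z => (g z).comp (A z)) (U ×ˢ Ico 0 ε) := by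
  have hN : ContDiffOn ℝ ∞ (fun z : E × ℝ => (N z.1, (0 : ℝ))) (U ×ˢ Ico 0 ε) :=
    h.contDiffOn_normal_comp.prodMk contDiffOn_const
  have hDN : ContDiffOn ℝ ∞ (fun z : E × ℝ => fderiv ℝ N z.1) (U ×ˢ Ico 0 ε) :=
    (h.contDiffOn_normal.fderiv_of_isOpen h.isOpen (by simp)).comp contDiffOn_fst fun _ hz => hz.1
  have hspace := (h.contDiffOn_truncate.fderivWithin h.uniqueDiffOn (m := ∞) (by simp)).clm_apply hN
  have haction : ContDiffOn ℝ ∞ (fun z => bilinAction (fderiv ℝ N z.1) (truncate (g z) (N z.1)))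
      (U ×ˢ Ico 0 ε) := by
    refine ContDiffOn.clm_apply ?_ h.contDiffOn_truncate
    exact (contDiffOn_const.clm_apply hDN).add
      (contDiffOn_const.clm_apply (contDiffOn_const.clm_apply hDN))
  exact ((hspace.add haction).const_smul (-(1 / 2) : ℝ)).congr fun z hz => h.secondForm_eq hC hz

theorem fderiv_truncate_time (h : IsLocalFlow U ε C g N A) (hz : z ∈ U ×ˢ Ioo 0 ε) :
    fderiv ℝ (fun z => truncate (g z) (N z.1)) z (0, 1) = C • (g z).comp (A z) := by
  have hz' : z ∈ U ×ˢ Ico 0 ε := ⟨hz.1, Ioo_subset_Ico_self hz.2⟩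
  have hd : DifferentiableAt ℝ (fun z => truncate (g z) (N z.1)) z :=
    (h.contDiffOn_truncate.differentiableOn (by simp) z hz').differentiableAt (h.mem_nhds hz)
  have hcurve : HasDerivAt (fun s : ℝ => (z.1, s)) (0, 1) z.2 :=
    (hasDerivAt_const _ _).prodMk (hasDerivAt_id _)
  have hg (u v : E) : HasDerivAt (fun s => g (z.1, s) u v) (C * g z (A z u) v) z.2 :=
    (h.evolution z hz' u v).hasDerivAt (Ico_mem_nhds hz.2.1 hz.2.2)
  ext u v
  have happly := hasFDerivAt_bilin_apply hd.hasFDerivAt u v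
  have htrunc : HasDerivAt (fun s => truncate (g (z.1, s)) (N z.1) u v)
      (fderiv ℝ (fun z => truncate (g z) (N z.1)) z (0, 1) u v) z.2 :=
    happly.comp_hasDerivAt_of_eq z.2 hcurve rfl
  have hformula := (hg u v).sub ((hg (N z.1) u).mul (hg (N z.1) v))
  rw [htrunc.unique (hformula.congr_of_eventuallyEq (.of_forall fun s => truncate_apply _ _ u v))]
  simp [h.apply_normal z hz']

theorem hasDerivAt_transport (h : IsLocalFlow U ε C g N A) (hC : C ≠ 0) {z : ℝ → E × ℝ} {s : ℝ}
    (hzs : z s ∈ U ×ˢ Ioo 0 ε) (hz : HasDerivAt z ((C / 2) • N (z s).1, 1) s) :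
    HasDerivAt (fun r => truncate (g (z r)) (N (z r).1))
        (-bilinAction ((C / 2) • fderiv ℝ N (z s).1) (truncate (g (z s)) (N (z s).1))) s ∧
      HasDerivAt (fun r => (g (z r)).comp (A (z r)))
        (-bilinAction ((C / 2) • fderiv ℝ N (z s).1) ((g (z s)).comp (A (z s)))) s := by
  have hnhds := (h.isOpen.prod isOpen_Ioo).mem_nhds hzs
  simp only [bilinAction_smul, ← neg_smul]
  exact hasDerivAt_of_lieTransport (R := fun x => bilinAction (fderiv ℝ N x))
    ((h.contDiffOn_truncate.contDiffAt (h.mem_nhds hzs)).of_le (by norm_cast))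
    (((h.contDiffOn_secondForm hC).contDiffAt (h.mem_nhds hzs)).differentiableAt (by simp))
    (eventually_of_mem hnhds fun w hw => by
      have hw' : w ∈ U ×ˢ Ico 0 ε := ⟨hw.1, Ioo_subset_Ico_self hw.2⟩
      rw [h.secondForm_eq hC hw', fderivWithin_of_mem_nhds (h.mem_nhds hw)])
    (eventually_of_mem hnhds fun w hw => h.fderiv_truncate_time hw) rfl hz

variable [FiniteDimensional ℝ E]

theorem contDiffOn_weingarten (h : IsLocalFlow U ε C g N A) (hC : C ≠ 0) :
    ContDiffOn ℝ ∞ A (U ×ˢ Ico 0 ε) := by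
  have hinv : ContDiffOn ℝ ∞ (fun z => (g z).inverse.comp ((g z).comp (A z))) (U ×ˢ Ico 0 ε) := by
    refine ContDiffOn.clm_comp (fun z hz => ?_) (h.contDiffOn_secondForm hC)
    have := FiniteDimensional.complete ℝ E
    obtain ⟨e, he⟩ := isInvertible_of_pos (h.pos z hz)
    have hinverse : ContDiffAt ℝ ∞ ContinuousLinearMap.inverse (g z) :=
      he ▸ contDiffAt_map_inverse e
    exact hinverse.comp_contDiffWithinAt z (h.contDiffOn_metric z hz)
  refine hinv.congr fun z hz => ?_
  obtain ⟨e, he⟩ := isInvertible_of_pos (h.pos z hz)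
  ext1 u
  simp [← he]

theorem continuousOn_traceCLM_pow (h : IsLocalFlow U ε C g N A) (hC : C ≠ 0) (i : ℕ) :
    ContinuousOn (fun z => traceCLM E (A z ^ i)) (U ×ˢ Ico 0 ε) :=
  (traceCLM E).continuous.comp_continuousOn ((h.contDiffOn_weingarten hC).continuousOn.pow i)

theorem hasDerivAt_traceCLM_pow (h : IsLocalFlow U ε C g N A) (hC : C ≠ 0) {z : ℝ → E × ℝ} {s : ℝ}
    (hzs : z s ∈ U ×ˢ Ioo 0 ε) (hz : HasDerivAt z ((C / 2) • N (z s).1, 1) s) (i : ℕ) :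
    HasDerivAt (fun r => traceCLM E (A (z r) ^ (i + 1))) 0 s := by
  have hzs' : z s ∈ U ×ˢ Ico 0 ε := ⟨hzs.1, Ioo_subset_Ico_self hzs.2⟩
  have hev : ∀ᶠ r in 𝓝 s, z r ∈ U ×ˢ Ico 0 ε := hz.continuousAt.eventually_mem (h.mem_nhds hzs)
  obtain ⟨hG, hB⟩ := h.hasDerivAt_transport hC hzs hz
  have hA : DifferentiableAt ℝ (fun r => A (z r)) s :=
    (((h.contDiffOn_weingarten hC).contDiffAt (h.mem_nhds hzs)).differentiableAt (by simp)).comp s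
      hz.differentiableAt
  have hN : HasDerivAt (fun r => N (z r).1) (((C / 2) • fderiv ℝ N (z s).1) (N (z s).1)) s := by
    rw [smul_apply, ← map_smul]
    exact (h.differentiableAt_normal hzs').hasFDerivAt.comp_hasDerivAt s hz.fst
  exact hasDerivAt_traceCLM_pow_of_transport hG hB hA hN
    (hev.mono fun r hr => h.truncate_comp_weingarten hC hr)
    (hev.mono fun r hr => h.apply_normal _ hr)
    (fun w hw => eq_smul_of_truncate_eq_zero (h.pos _ hzs') hw) i

end IsLocalFlow

end LocalFlow

section Coordinates

variable {E : Type*} [NormedAddCommGroup E] [NormedSpace ℝ E]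
  {H : Type*} [TopologicalSpace H] {I : ModelWithCorners ℝ E H}
  {M : Type*} [TopologicalSpace M] [ChartedSpace H M]

section Frame

variable [IsManifold I 1 M]

/-- The coordinate frame at `p` of the preferred chart at `x`: it sends a vector of the model space
to the tangent vector with these coordinates. -/
def coordFrame (I : ModelWithCorners ℝ E H) {M : Type*} [TopologicalSpace M] [ChartedSpace H M]
    [IsManifold I 1 M] (x p : M) : E →L[ℝ] TangentSpace I p :=
  (trivializationAt E (TangentSpace I) x).symmL ℝ p

/-- The coordinates of tangent vectors at `p` in the preferred chart at `x`. -/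
def coordMap (I : ModelWithCorners ℝ E H) {M : Type*} [TopologicalSpace M] [ChartedSpace H M]
    [IsManifold I 1 M] (x p : M) : TangentSpace I p →L[ℝ] E :=
  (trivializationAt E (TangentSpace I) x).continuousLinearMapAt ℝ p

/-- The coordinate representation of a vector field in the preferred chart at `x`. -/
def localField (I : ModelWithCorners ℝ E H) {M : Type*} [TopologicalSpace M] [ChartedSpace H M]
    [IsManifold I 1 M] (V : (p : M) → TangentSpace I p) (x : M) (y : E) : E :=
  coordMap I x ((extChartAt I x).symm y) (V ((extChartAt I x).symm y))

/-- The coordinate expression at `y`, in the preferred chart at `x`, of a field `β` of bilinear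
forms. -/
def localBilin (I : ModelWithCorners ℝ E H) {M : Type*} [TopologicalSpace M] [ChartedSpace H M]
    [IsManifold I 1 M] (β : (p : M) → TangentSpace I p →L[ℝ] TangentSpace I p →L[ℝ] ℝ) (x : M)
    (y : E) : E →L[ℝ] E →L[ℝ] ℝ :=
  (ContinuousLinearMap.precomp ℝ (coordFrame I x ((extChartAt I x).symm y))).comp
    ((β ((extChartAt I x).symm y)).comp (coordFrame I x ((extChartAt I x).symm y)))

variable {x p : M} {y : E}

theorem mem_trivializationAt_baseSet (hp : p ∈ (extChartAt I x).source) :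
    p ∈ (trivializationAt E (TangentSpace I) x).baseSet := by
  simpa using hp

theorem coordFrame_coordMap (hp : p ∈ (extChartAt I x).source) (v : TangentSpace I p) :
    coordFrame I x p (coordMap I x p v) = v :=
  Trivialization.symmL_continuousLinearMapAt _ (mem_trivializationAt_baseSet hp) v

theorem coordMap_coordFrame (hp : p ∈ (extChartAt I x).source) (u : E) :
    coordMap I x p (coordFrame I x p u) = u :=
  Trivialization.continuousLinearMapAt_symmL _ (mem_trivializationAt_baseSet hp) u

theorem coordFrame_localField (V : (p : M) → TangentSpace I p) (hy : y ∈ (extChartAt I x).target) :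
    coordFrame I x ((extChartAt I x).symm y) (localField I V x y) = V ((extChartAt I x).symm y) :=
  coordFrame_coordMap ((extChartAt I x).map_target hy) _

theorem localBilin_apply (β : (p : M) → TangentSpace I p →L[ℝ] TangentSpace I p →L[ℝ] ℝ) (x : M)
    (y u v : E) : localBilin I β x y u v = β ((extChartAt I x).symm y)
      (coordFrame I x ((extChartAt I x).symm y) u) (coordFrame I x ((extChartAt I x).symm y) v) :=
  rfl

variable [I.Boundaryless]

theorem mfderiv_extChartAt_symm (hy : y ∈ (extChartAt I x).target) :
    mfderiv 𝓘(ℝ, E) I (extChartAt I x).symm y = coordFrame I x ((extChartAt I x).symm y) := by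
  have hframe := TangentBundle.symmL_trivializationAt (I := I) (x₀ := x)
    (x := (extChartAt I x).symm y) (by simpa using (extChartAt I x).map_target hy)
  rw [I.range_eq_univ, mfderivWithin_univ] at hframe
  have hbase : (mfderiv 𝓘(ℝ, E) I (extChartAt I x).symm
      (extChartAt I x ((extChartAt I x).symm y)) : E →L[ℝ] E) =
      mfderiv 𝓘(ℝ, E) I (extChartAt I x).symm y := by
    rw [(extChartAt I x).right_inv hy]
  exact hbase.symm.trans hframe.symm

theorem hasMFDerivAt_extChartAt_symm (hy : y ∈ (extChartAt I x).target) :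
    HasMFDerivAt 𝓘(ℝ, E) I (extChartAt I x).symm y
      (coordFrame I x ((extChartAt I x).symm y)) :=
  mfderiv_extChartAt_symm hy ▸ ((mdifferentiableOn_extChartAt_symm y hy).mdifferentiableAt
    ((isOpen_extChartAt_target x).mem_nhds hy)).hasMFDerivAt

theorem mpullback_extChartAt_symm (V : (p : M) → TangentSpace I p)
    (hy : y ∈ (extChartAt I x).target) :
    mpullback 𝓘(ℝ, E) I (extChartAt I x).symm V y = localField I V x y := by
  have hp := (extChartAt I x).map_target hy
  have hinverse : (coordFrame I x ((extChartAt I x).symm y)).inverse =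
      coordMap I x ((extChartAt I x).symm y) :=
    ContinuousLinearMap.inverse_eq (ContinuousLinearMap.ext (coordFrame_coordMap hp))
      (ContinuousLinearMap.ext (coordMap_coordFrame hp))
  rw [mpullback_apply, mfderiv_extChartAt_symm hy]
  exact congr($hinverse (V ((extChartAt I x).symm y)))

theorem mvfderiv_coordFrame (hy : y ∈ (extChartAt I x).target) {F : Type*}
    [NormedAddCommGroup F] [NormedSpace ℝ F] {f : M → F}
    (hf : MDifferentiableAt I 𝓘(ℝ, F) f ((extChartAt I x).symm y)) (u : E) :
    d% f ((extChartAt I x).symm y) (coordFrame I x ((extChartAt I x).symm y) u) =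
      fderiv ℝ (fun y => f ((extChartAt I x).symm y)) y u := by
  have hcomp := mfderiv_comp y hf (hasMFDerivAt_extChartAt_symm hy).mdifferentiableAt
  rw [mfderiv_eq_fderiv, mfderiv_extChartAt_symm hy] at hcomp
  exact congr(($hcomp : E →L[ℝ] F) u).symm

end Frame

variable [IsManifold I ∞ M] {x p : M} {y : E}

theorem contMDiffOn_coordFrame (u : E) :
    ContMDiffOn I I.tangent ∞ (fun p => (⟨p, coordFrame I x p u⟩ : TangentBundle I M))
      (extChartAt I x).source := by
  have hsymm :=
    (trivializationAt E (TangentSpace I : M → Type _) x).contMDiffOn_symm (IB := I) (n := ∞)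
  have hpair : ContMDiffOn I (I.prod 𝓘(ℝ, E)) ∞ (fun p : M => (p, u)) (extChartAt I x).source :=
    contMDiffOn_id.prodMk contMDiffOn_const
  refine (hsymm.comp hpair fun p hp => ?_).congr fun p hp => ?_
  · exact (Trivialization.mem_target _).2 (mem_trivializationAt_baseSet hp)
  · have hmem := mem_trivializationAt_baseSet (I := I) hp
    rw [Function.comp_apply, ← Trivialization.mk_symm _ hmem, coordFrame,
      Trivialization.symmL_apply _ hmem]

theorem mdifferentiableAt_coordFrame (hp : p ∈ (extChartAt I x).source) (u : E) :
    MDiffAt (T% (fun p => coordFrame I x p u)) p :=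
  ((contMDiffOn_coordFrame u).contMDiffAt
    ((isOpen_extChartAt_source x).mem_nhds hp)).mdifferentiableAt (by simp)

theorem contDiffOn_localField {V : (p : M) → TangentSpace I p}
    (hV : ContMDiff I I.tangent ∞ (fun p => (⟨p, V p⟩ : TangentBundle I M))) :
    ContDiffOn ℝ ∞ (localField I V x) (extChartAt I x).target := by
  have hsection := ((trivializationAt E (TangentSpace I : M → Type _) x)
    |>.contMDiffOn_section_baseSet_iff (IB := I) (n := ∞) (s := V)).1 hV.contMDiffOn
  have hmem (y : E) (hy : y ∈ (extChartAt I x).target) :=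
    mem_trivializationAt_baseSet (I := I) ((extChartAt I x).map_target hy)
  refine (hsection.comp (contMDiffOn_extChartAt_symm x) hmem).contDiffOn.congr fun y hy => ?_
  rw [localField, coordMap, Trivialization.continuousLinearMapAt_apply,
    Trivialization.linearMapAt_apply, if_pos (hmem y hy)]
  rfl

theorem contDiffOn_localBilin [FiniteDimensional ℝ E]
    {β : ℝ → (p : M) → TangentSpace I p →L[ℝ] TangentSpace I p →L[ℝ] ℝ} {S : Set ℝ}
    (hβ : ContMDiffOn (I.prod 𝓘(ℝ, ℝ)) (I.prod 𝓘(ℝ, E →L[ℝ] E →L[ℝ] ℝ)) ∞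
      (fun z : M × ℝ => TotalSpace.mk' (E →L[ℝ] E →L[ℝ] ℝ)
        (E := fun p : M => TangentSpace I p →L[ℝ] TangentSpace I p →L[ℝ] ℝ) z.1 (β z.2 z.1))
      (univ ×ˢ S)) (x : M) :
    ContDiffOn ℝ ∞ (fun z : E × ℝ => localBilin I (β z.2) x z.1)
      ((extChartAt I x).target ×ˢ S) := by
  refine contDiffOn_clm_apply.2 fun u => contDiffOn_clm_apply.2 fun v => ?_
  have hfst : ContMDiffOn 𝓘(ℝ, E × ℝ) I ∞ (fun z : E × ℝ => (extChartAt I x).symm z.1)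
      ((extChartAt I x).target ×ˢ S) :=
    (contMDiffOn_extChartAt_symm x).comp (contMDiff_iff_contDiff.2 contDiff_fst).contMDiffOn
      fun z hz => hz.1
  have hβ' := hβ.comp (hfst.prodMk (contMDiff_iff_contDiff.2 contDiff_snd).contMDiffOn)
    fun z hz => ⟨mem_univ _, hz.2⟩
  have hframe (u : E) : ContMDiffOn 𝓘(ℝ, E × ℝ) (I.prod 𝓘(ℝ, E)) ∞
      (fun z : E × ℝ => TotalSpace.mk' E (E := fun p : M => TangentSpace I p)
        ((extChartAt I x).symm z.1) (coordFrame I x ((extChartAt I x).symm z.1) u))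
      ((extChartAt I x).target ×ˢ S) :=
    (contMDiffOn_coordFrame u).comp hfst fun z hz => (extChartAt I x).map_target hz.1
  have happly : ContMDiffOn 𝓘(ℝ, E × ℝ) (I.prod 𝓘(ℝ, ℝ)) ∞
      (fun z : E × ℝ => TotalSpace.mk' ℝ (E := Bundle.Trivial M ℝ) ((extChartAt I x).symm z.1)
        (localBilin I (β z.2) x z.1 u v)) ((extChartAt I x).target ×ˢ S) := by
    apply ContMDiffOn.clm_bundle_apply₂ (F₁ := E) (F₂ := E)
    · exact hβ'
    · exact hframe u
    · exact hframe v
  exact fun z hz =>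
    contMDiffWithinAt_iff_contDiffWithinAt.1 (contMDiffWithinAt_totalSpace.1 (happly z hz)).2

theorem mlieBracket_eq_lieBracket (V W : (y : E) → TangentSpace 𝓘(ℝ, E) y) (y : E) :
    mlieBracket 𝓘(ℝ, E) V W y = lieBracket ℝ V W y := by
  rw [← mlieBracketWithin_univ, mlieBracketWithin_eq_lieBracketWithin]
  exact congrFun lieBracketWithin_univ y

variable [I.Boundaryless] [CompleteSpace E]

theorem mlieBracket_extChartAt_symm {V W : (p : M) → TangentSpace I p}
    (hy : y ∈ (extChartAt I x).target) (hV : MDiffAt (T% V) ((extChartAt I x).symm y))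
    (hW : MDiffAt (T% W) ((extChartAt I x).symm y)) :
    mlieBracket I V W ((extChartAt I x).symm y) = coordFrame I x ((extChartAt I x).symm y)
      (lieBracket ℝ (localField I V x) (localField I W x) y) := by
  have htarget := (isOpen_extChartAt_target (I := I) x).mem_nhds hy
  have hpull (V : (p : M) → TangentSpace I p) :
      mpullback 𝓘(ℝ, E) I (extChartAt I x).symm V =ᶠ[𝓝 y] localField I V x :=
    eventually_of_mem htarget fun y hy => mpullback_extChartAt_symm V hy
  have : IsManifold I (minSmoothness ℝ 2) M := .of_le (n := ∞) (by simp; norm_cast)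
  have hbracket := mpullback_mlieBracket hV hW
    ((contMDiffOn_extChartAt_symm (n := ∞) x).contMDiffAt htarget) (by simp; norm_cast)
  rw [← coordFrame_localField (mlieBracket I V W) hy, ← mpullback_extChartAt_symm _ hy]
  exact congrArg _ <| (hbracket.trans (mlieBracket_eq_lieBracket _ _ y)).trans
    ((hpull V).lieBracket_vectorField_eq (hpull W))

theorem mlieBracket_coordFrame {V : (p : M) → TangentSpace I p}
    (hy : y ∈ (extChartAt I x).target) (hV : MDiffAt (T% V) ((extChartAt I x).symm y)) (u : E) :
    mlieBracket I (fun p => coordFrame I x p u) V ((extChartAt I x).symm y) =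
      coordFrame I x ((extChartAt I x).symm y) (fderiv ℝ (localField I V x) y u) := by
  rw [mlieBracket_extChartAt_symm hy
    (mdifferentiableAt_coordFrame ((extChartAt I x).map_target hy) u) hV]
  have hconst : localField I (fun p => coordFrame I x p u) x =ᶠ[𝓝 y] fun _ => u :=
    eventually_of_mem ((isOpen_extChartAt_target x).mem_nhds hy) fun y hy =>
      coordMap_coordFrame ((extChartAt I x).map_target hy) u
  rw [hconst.lieBracket_vectorField_eq .rfl]
  simp [lieBracket]

end Coordinates

section LeviCivitaCoordinates

variable {E : Type*} [NormedAddCommGroup E] [NormedSpace ℝ E] [FiniteDimensional ℝ E]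
  [CompleteSpace E] {H : Type*} [TopologicalSpace H] {I : ModelWithCorners ℝ E H}
  {M : Type*} [TopologicalSpace M] [ChartedSpace H M] [IsManifold I ∞ M]

/-- The right-hand side is the Lie derivative of the metric along `N`, evaluated on `X` and `Y`. -/
theorem inner_leviCivita_add_inner_leviCivita
    (g : ContMDiffRiemannianMetric I ∞ E (fun p : M => TangentSpace I p))
    {X Y N : (p : M) → TangentSpace I p} {p : M} (hX : MDiffAt (T% X) p) (hY : MDiffAt (T% Y) p)
    (hN : MDiffAt (T% N) p) :
    g.inner p (leviCivita g N p (X p)) (Y p) + g.inner p (leviCivita g N p (Y p)) (X p) =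
      d% (fun p => g.inner p (X p) (Y p)) p (N p) + g.inner p (mlieBracket I X N p) (Y p)
        + g.inner p (X p) (mlieBracket I Y N p) := by
  have hXY : g.inner p (leviCivita g N p (X p)) (Y p) = _ := inner_leviCivitaFun g hX hN hY
  have hYX : g.inner p (leviCivita g N p (Y p)) (X p) = _ := inner_leviCivitaFun g hY hN hX
  have hswap (X Y : (p : M) → TangentSpace I p) :
      (fun p => g.inner p (Y p) (X p)) = fun p => g.inner p (X p) (Y p) :=
    funext fun p => g.symm p _ _
  rw [hXY, hYX]
  simp only [koszulForm, hswap X Y, hswap X N, hswap Y N,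
    mlieBracket_swap_apply (I := I) (V := N) (W := X),
    mlieBracket_swap_apply (I := I) (V := N) (W := Y),
    mlieBracket_swap_apply (I := I) (V := Y) (W := X), g.symm p (X p), map_neg, neg_apply]
  ring

theorem inner_leviCivita_coordFrame [I.Boundaryless]
    (g : ContMDiffRiemannianMetric I ∞ E (fun p : M => TangentSpace I p))
    {N : (p : M) → TangentSpace I p} {x : M} {y : E} (hy : y ∈ (extChartAt I x).target)
    (hN : MDiffAt (T% N) ((extChartAt I x).symm y))
    (hg : DifferentiableAt ℝ (localBilin I g.inner x) y) (u v : E) :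
    g.inner _ (leviCivita g N _ (coordFrame I x ((extChartAt I x).symm y) u))
        (coordFrame I x ((extChartAt I x).symm y) v)
      + g.inner _ (leviCivita g N _ (coordFrame I x ((extChartAt I x).symm y) v))
        (coordFrame I x ((extChartAt I x).symm y) u) =
      lieDerivBilin (localField I N x) (localBilin I g.inner x) y u v := by
  have hframe := mdifferentiableAt_coordFrame (I := I) ((extChartAt I x).map_target hy)
  have hmetric := mvfderiv_coordFrame hy (metric_mdiffAt g (hframe u) (hframe v))
    (localField I N x y)
  rw [coordFrame_localField N hy] at hmetric
  have hbilin := (hasFDerivAt_bilin_apply hg.hasFDerivAt u v).fderiv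
  simp only [localBilin_apply] at hbilin
  rw [inner_leviCivita_add_inner_leviCivita g (hframe u) (hframe v) hN, hmetric, hbilin,
    mlieBracket_coordFrame hy hN, mlieBracket_coordFrame hy hN]
  simp [lieDerivBilin, bilinAction_apply, localBilin_apply, add_assoc]

end LeviCivitaCoordinates

section UnitNormal

theorem eq_of_hasDerivWithinAt_zero {F : Type*} [NormedAddCommGroup F] [NormedSpace ℝ F]
    {f : ℝ → F} {S : Set ℝ} (hS : Convex ℝ S) (hf : ∀ s ∈ S, HasDerivWithinAt f 0 S s) {a b : ℝ}
    (ha : a ∈ S) (hb : b ∈ S) : f a = f b := by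
  have hbound := hS.norm_image_sub_le_of_norm_hasDerivWithin_le (C := 0) hf (fun _ _ => by simp)
    hb ha
  rwa [zero_mul, norm_le_zero_iff, sub_eq_zero] at hbound

theorem differentiableWithinAt_clm_of_apply {D E F : Type*} [NormedAddCommGroup D]
    [NormedSpace ℝ D] [NormedAddCommGroup E] [NormedSpace ℝ E] [FiniteDimensional ℝ E]
    [NormedAddCommGroup F] [NormedSpace ℝ F] {f : D → E →L[ℝ] F} {S : Set D} {x : D}
    (h : ∀ v, DifferentiableWithinAt ℝ (fun y => f y v) S x) : DifferentiableWithinAt ℝ f S x := by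
  let b := Module.finBasis ℝ E
  have hf : f = fun y => ∑ i, ContinuousLinearMap.smulRightL ℝ E F
      (LinearMap.toContinuousLinearMap (b.coord i)) (f y (b i)) := by
    ext y v
    conv_lhs => rw [← b.sum_repr v, map_sum]
    simp
  rw [hf]
  exact .fun_sum fun i _ => (ContinuousLinearMap.differentiableAt _).comp_differentiableWithinAt x
    (h (b i))

theorem hasDerivWithinAt_inverse_apply {E F : Type*} [NormedAddCommGroup E] [NormedSpace ℝ E]
    [CompleteSpace E] [NormedAddCommGroup F] [NormedSpace ℝ F] {β : ℝ → E →L[ℝ] F}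
    {β' : E →L[ℝ] F} {S : Set ℝ} {t : ℝ} {w : F} (hβ : HasDerivWithinAt β β' S t)
    (hinv : ∀ s ∈ S, (β s).IsInvertible) (ht : t ∈ S) (hS : UniqueDiffWithinAt ℝ S t)
    (hw : β' ((β t).inverse w) = 0) :
    HasDerivWithinAt (fun s => (β s).inverse w) 0 S t := by
  have hdiff : DifferentiableWithinAt ℝ (fun s => (β s).inverse w) S t :=
    (((hinv t ht).contDiffAt_map_inverse (n := 1)).differentiableAt (by simp)
      |>.comp_differentiableWithinAt t hβ.differentiableWithinAt).clm_apply
      (differentiableWithinAt_const w)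
  have hself : HasDerivWithinAt (fun s => β s ((β s).inverse w)) 0 S t :=
    (hasDerivWithinAt_const t S w).congr (fun s hs => (hinv s hs).self_apply_inverse w)
      ((hinv t ht).self_apply_inverse w)
  have hprod := hS.eq_deriv _ (hβ.clm_apply hdiff.hasDerivWithinAt) hself
  rw [hw, zero_add] at hprod
  have hzero := (hinv t ht).injective (hprod.trans (map_zero (β t)).symm)
  exact hzero ▸ hdiff.hasDerivWithinAt

variable {E : Type*} [NormedAddCommGroup E] [NormedSpace ℝ E]

theorem eq_smul_of_ker_le {φ α : E →L[ℝ] ℝ} (h : ∀ v, α v = 0 → φ v = 0) {ν : E} (hν : α ν ≠ 0) :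
    φ = (φ ν / α ν) • α := by
  ext v
  have hv := h (v - (α v / α ν) • ν) (by simp [hν])
  rw [map_sub, map_smul, sub_eq_zero] at hv
  rw [hv, smul_apply, smul_eq_mul, smul_eq_mul]
  ring

theorem smul_eq_smul_of_unit {m ν : E} {α : E →L[ℝ] ℝ} {c d : ℝ} (hc : c * (c * α m) = 1)
    (hd : d * (d * α m) = 1) (hcν : 0 < c * α ν) (hdν : 0 < d * α ν) : c • m = d • m := by
  have hm : α m ≠ 0 := fun h => by simp [h] at hc
  have hsq : c ^ 2 = d ^ 2 := mul_right_cancel₀ hm (by linear_combination hc - hd)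
  rcases sq_eq_sq_iff_eq_or_eq_neg.1 hsq with h | h
  · rw [h]
  · rw [h] at hcν
    linarith

/-- `N` is a multiple of `g⁻¹ α`, which is constant since its derivative `-g⁻¹ (b (g⁻¹ α))` is a
multiple of `g⁻¹ (b N) = 0`. -/
theorem unitNormal_eq [FiniteDimensional ℝ E] {S : Set ℝ} (hS : Convex ℝ S)
    (hSd : UniqueDiffOn ℝ S) {g b : ℝ → E →L[ℝ] E →L[ℝ] ℝ} {N : ℝ → E} {ν : E} {α : E →L[ℝ] ℝ}
    (hpos : ∀ t ∈ S, ∀ u ≠ 0, 0 < g t u u) (hg : ∀ t ∈ S, HasDerivWithinAt g (b t) S t)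
    (hunit : ∀ t ∈ S, g t (N t) (N t) = 1) (hnormal : ∀ t ∈ S, ∀ v, α v = 0 → g t (N t) v = 0)
    (hν : ∀ t ∈ S, 0 < g t (N t) ν) (hb : ∀ t ∈ S, b t (N t) = 0) {s t : ℝ} (hs : s ∈ S)
    (ht : t ∈ S) : N s = N t := by
  have := FiniteDimensional.complete ℝ E
  have hαν : α ν ≠ 0 := fun h => (hν t ht).ne' (hnormal t ht ν h)
  have hinv (t) (ht : t ∈ S) := isInvertible_of_pos (hpos t ht)
  have hflat (t) (ht : t ∈ S) : g t (N t) = (g t (N t) ν / α ν) • α :=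
    eq_smul_of_ker_le (hnormal t ht) hαν
  have hN (t) (ht : t ∈ S) : N t = (g t (N t) ν / α ν) • (g t).inverse α := by
    rw [← map_smul, ← hflat t ht, (hinv t ht).inverse_apply_self]
  have hinverse : (g s).inverse α = (g t).inverse α := by
    refine eq_of_hasDerivWithinAt_zero (f := fun t => (g t).inverse α) hS (fun t ht => ?_) hs ht
    refine hasDerivWithinAt_inverse_apply (hg t ht) hinv ht (hSd t ht) ?_
    have hc : g t (N t) ν / α ν ≠ 0 := div_ne_zero (hν t ht).ne' hαν
    rw [← inv_smul_smul₀ hc ((g t).inverse α), ← hN t ht, map_smul, hb t ht, smul_zero]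
  have hunit' (t) (ht : t ∈ S) :
      g t (N t) ν / α ν * (g t (N t) ν / α ν * α ((g t).inverse α)) = 1 := by
    rw [← smul_eq_mul (a := g t (N t) ν / α ν) (b := α _), ← map_smul, ← hN t ht]
    exact congr($(hflat t ht) (N t)).symm.trans (hunit t ht)
  have hpos' (t) (ht : t ∈ S) : 0 < g t (N t) ν / α ν * α ν := by
    rw [div_mul_cancel₀ _ hαν]
    exact hν t ht
  rw [hN s hs, hN t ht, hinverse]
  exact smul_eq_smul_of_unit (ν := ν) (hinverse ▸ hunit' s hs) (hunit' t ht) (hpos' s hs)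
    (hpos' t ht)

end UnitNormal

section Foliation

variable {E : Type*} [NormedAddCommGroup E] [NormedSpace ℝ E] {M : Type*} [TopologicalSpace M]
  [ChartedSpace E M]

theorem symm_mem_of_mem_connectedComponentIn {X Y : Type*} [TopologicalSpace X]
    [TopologicalSpace Y] (e : OpenPartialHomeomorph X Y) {L : Set X} {y z : Y}
    (hy : y ∈ connectedComponentIn (e '' (e.source ∩ L)) z) : e.symm y ∈ L := by
  obtain ⟨p, hp, rfl⟩ := connectedComponentIn_subset _ _ hy
  exact (e.left_inv hp.1).symm ▸ hp.2

theorem tangentMap_line (y u : E) :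
    tangentMap 𝓘(ℝ, ℝ) 𝓘(ℝ, E) (fun s : ℝ => y + s • u) ⟨0, (1 : ℝ)⟩ =
      (⟨y, u⟩ : TangentBundle 𝓘(ℝ, E) E) := by
  have hline : HasDerivAt (fun s : ℝ => y + s • u) ((1 : ℝ) • u) 0 :=
    ((hasDerivAt_id (0 : ℝ)).smul_const u).const_add y
  have hvelocity : (mfderiv 𝓘(ℝ, ℝ) 𝓘(ℝ, E) (fun s : ℝ => y + s • u) 0 : ℝ →L[ℝ] E) 1 = u := by
    rw [mfderiv_eq_fderiv]
    exact hline.deriv.trans (one_smul ℝ u)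
  exact TotalSpace.ext (by simp) (heq_of_eq hvelocity)

theorem tangentMap_symm_line {e : OpenPartialHomeomorph M E}
    (he : e.MDifferentiable 𝓘(ℝ, E) 𝓘(ℝ, E)) {q : M} (hq : q ∈ e.source)
    {v : TangentSpace 𝓘(ℝ, E) q} {u : E} (hu : mfderiv 𝓘(ℝ, E) 𝓘(ℝ, E) e q v = u) :
    tangentMap 𝓘(ℝ, ℝ) 𝓘(ℝ, E) (e.symm ∘ fun s : ℝ => e q + s • u) ⟨0, (1 : ℝ)⟩ =
      (⟨q, v⟩ : TangentBundle 𝓘(ℝ, E) M) := by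
  have hline : MDifferentiableAt 𝓘(ℝ, ℝ) 𝓘(ℝ, E) (fun s : ℝ => e q + s • u) 0 :=
    ((differentiableAt_id.smul_const u).const_add (e q)).mdifferentiableAt
  have hsymm : MDifferentiableAt 𝓘(ℝ, E) 𝓘(ℝ, E) e.symm (e q + (0 : ℝ) • u) := by
    rw [zero_smul, add_zero]
    exact he.mdifferentiableAt_symm (e.map_source hq)
  refine ((tangentMap_comp_at _ hsymm hline).trans (congrArg _ (tangentMap_line (e q) u))).trans ?_
  subst hu
  exact TotalSpace.ext (e.left_inv hq) (heq_of_eq congr($(he.symm_comp_deriv hq) v))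

theorem Foliation.exists_leaf {n : ℕ} {M : Type*} [TopologicalSpace M]
    [ChartedSpace (EuclideanSpace ℝ (Fin (n + 1))) M] (F : Foliation n M) (q : M) :
    ∃ L ∈ F.leaves, q ∈ L := by
  have hq : q ∈ ⋃₀ F.leaves := F.cover ▸ mem_univ q
  simpa only [mem_sUnion] using hq

theorem Foliation.exists_ker_isTangent {n : ℕ} {M : Type*} [TopologicalSpace M]
    [ChartedSpace (EuclideanSpace ℝ (Fin (n + 1))) M] (F : Foliation n M) (q : M) :
    ∃ α : TangentSpace (𝓡 (n + 1)) q →L[ℝ] ℝ, ∀ v, α v = 0 → F.IsTangent q v := by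
  obtain ⟨e, he, hq, -, hslice⟩ := F.exists_chart q
  obtain ⟨L, hL, hqL⟩ := F.exists_leaf q
  have hmd : e.MDifferentiable (𝓡 (n + 1)) (𝓡 (n + 1)) :=
    ⟨(contMDiffOn_of_mem_maximalAtlas he).mdifferentiableOn (by simp),
      (contMDiffOn_symm_of_mem_maximalAtlas he).mdifferentiableOn (by simp)⟩
  let d : EuclideanSpace ℝ (Fin (n + 1)) →L[ℝ] EuclideanSpace ℝ (Fin (n + 1)) :=
    mfderiv (𝓡 (n + 1)) (𝓡 (n + 1)) e q
  refine ⟨(EuclideanSpace.proj (Fin.last n)).comp d, fun v (hv : d v (Fin.last n) = 0) => ?_⟩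
  have hline : ContDiff ℝ ∞ fun s : ℝ => e q + s • d v :=
    contDiff_const.add (contDiff_id.smul contDiff_const)
  have htarget : e.target ∈ 𝓝 (e q + (0 : ℝ) • d v) := by
    simpa only [zero_smul, add_zero] using e.open_target.mem_nhds (e.map_source hq)
  refine ⟨L, hL, e.symm ∘ fun s : ℝ => e q + s • d v, ?_, ?_, tangentMap_symm_line hmd hq rfl⟩
  · exact ((contMDiffOn_symm_of_mem_maximalAtlas he).contMDiffAt htarget).comp (0 : ℝ)
      hline.contMDiff.contMDiffAt
  · filter_upwards [hline.continuous.continuousAt.eventually_mem htarget] with s hs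
    refine symm_mem_of_mem_connectedComponentIn e (z := e q) ?_
    rw [hslice L hL q ⟨hq, hqL⟩]
    exact ⟨hs, by simp [hv]⟩

end Foliation

section Weingarten

variable {n : ℕ} {M : Type*} [TopologicalSpace M]
  [ChartedSpace (EuclideanSpace ℝ (Fin (n + 1))) M] [IsManifold (𝓡 (n + 1)) ∞ M]
  {g : RMetric n M} {N : VField n M} {p : M}

theorem tangentialPart_apply (g : RMetric n M) (N : VField n M) (p : M)
    (v : TangentSpace (𝓡 (n + 1)) p) :
    tangentialPart g N p v = v - g.inner p (N p) v • N p := rfl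

theorem weingarten_apply (g : RMetric n M) (N : VField n M) (p : M)
    (v : TangentSpace (𝓡 (n + 1)) p) :
    weingarten g N p v = -leviCivita g N p (tangentialPart g N p v) := rfl

theorem tangentialPart_of_inner_eq_zero {v : TangentSpace (𝓡 (n + 1)) p}
    (hv : g.inner p (N p) v = 0) : tangentialPart g N p v = v := by
  rw [tangentialPart_apply, hv, zero_smul, sub_zero]

theorem tangentialPart_normal (hunit : g.inner p (N p) (N p) = 1) :
    tangentialPart g N p (N p) = 0 := by
  rw [tangentialPart_apply, hunit, one_smul, sub_self]

theorem inner_normal_tangentialPart (hunit : g.inner p (N p) (N p) = 1)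
    (v : TangentSpace (𝓡 (n + 1)) p) : g.inner p (N p) (tangentialPart g N p v) = 0 := by
  rw [tangentialPart_apply, map_sub, map_smul, hunit, smul_eq_mul, mul_one, sub_self]

theorem weingarten_tangentialPart (hunit : g.inner p (N p) (N p) = 1)
    (v : TangentSpace (𝓡 (n + 1)) p) :
    weingarten g N p (tangentialPart g N p v) = weingarten g N p v := by
  rw [weingarten_apply, weingarten_apply,
    tangentialPart_of_inner_eq_zero (inner_normal_tangentialPart hunit v)]

theorem weingarten_normal (hunit : g.inner p (N p) (N p) = 1) : weingarten g N p (N p) = 0 := by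
  rw [weingarten_apply, tangentialPart_normal hunit, map_zero, neg_zero]

theorem bHat_normal (hunit : g.inner p (N p) (N p) = 1) (j : ℕ)
    (w : TangentSpace (𝓡 (n + 1)) p) : bHat g N j p (N p) w = 0 := by
  rw [bHat, tangentialPart_normal hunit, map_zero, map_zero, zero_apply]

theorem IsSmoothField.mdifferentiableAt (hN : IsSmoothField N) (p : M) :
    MDifferentiableAt (𝓡 (n + 1)) (𝓡 (n + 1)).tangent
      (fun p => (⟨p, N p⟩ : TangentBundle (𝓡 (n + 1)) M)) p :=
  ContMDiff.mdifferentiable hN (by simp) p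

theorem inner_weingarten_normal (hN : IsSmoothField N) (hunit : ∀ p, g.inner p (N p) (N p) = 1)
    (v : TangentSpace (𝓡 (n + 1)) p) : g.inner p (weingarten g N p v) (N p) = 0 := by
  have hw := FiberBundle.mdifferentiableAt_extend (𝓡 (n + 1)) (EuclideanSpace ℝ (Fin (n + 1)))
    (tangentialPart g N p v)
  have hmetric := leviCivita_metric g hw (hN.mdifferentiableAt p) (hN.mdifferentiableAt p)
  rw [FiberBundle.extend_apply_self, funext hunit, mvfderiv_const, zero_apply,
    g.symm p (N p)] at hmetric
  rw [weingarten_apply, map_neg, neg_apply]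
  linarith

theorem bHat_one (hN : IsSmoothField N) (hunit : ∀ p, g.inner p (N p) (N p) = 1)
    (v w : TangentSpace (𝓡 (n + 1)) p) :
    bHat g N 1 p v w = g.inner p (weingarten g N p v) w := by
  rw [bHat, pow_one, weingarten_tangentialPart (hunit p), tangentialPart_apply g N p w, map_sub,
    map_smul, inner_weingarten_normal hN hunit, smul_zero, sub_zero]

theorem powerSum_zero (hunit : g.inner p (N p) (N p) = 1) : powerSum g N 0 p = n := by
  have htrace (θ : EuclideanSpace ℝ (Fin (n + 1)) →ₗ[ℝ] ℝ) (w : EuclideanSpace ℝ (Fin (n + 1)))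
      (hw : θ w = 1) :
      LinearMap.trace ℝ (EuclideanSpace ℝ (Fin (n + 1))) (LinearMap.id - θ.smulRight w) = n := by
    rw [map_sub, LinearMap.trace_smulRight, LinearMap.trace_id, hw, finrank_euclideanSpace_fin]
    simp
  exact htrace (g.inner p (N p)).toLinearMap (N p) hunit

theorem powerSum_succ (hunit : g.inner p (N p) (N p) = 1) (i : ℕ) :
    powerSum g N (i + 1) p = LinearMap.trace ℝ (TangentSpace (𝓡 (n + 1)) p)
      (weingarten g N p ^ (i + 1)).toLinearMap := by
  have hcomp : (weingarten g N p).comp (tangentialPart g N p) = weingarten g N p :=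
    ContinuousLinearMap.ext (weingarten_tangentialPart hunit)
  rw [powerSum, pow_succ, ContinuousLinearMap.mul_def, ContinuousLinearMap.comp_assoc, hcomp]

end Weingarten

section Evolution

variable {n : ℕ} {M : Type*} [TopologicalSpace M]
  [ChartedSpace (EuclideanSpace ℝ (Fin (n + 1))) M] [IsManifold (𝓡 (n + 1)) ∞ M]

/-- A solution of `∂_t g_t = C b̂_1^t` whose unit normal field `N` does not depend on time; the
foliation enters through `N` only. -/
structure IsSecondFormFlow (C ε : ℝ) (g : ℝ → RMetric n M) (N : VField n M) : Prop where
  smooth : ContMDiffOn ((𝓡 (n + 1)).prod 𝓘(ℝ, ℝ))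
    ((𝓡 (n + 1)).prod 𝓘(ℝ, EuclideanSpace ℝ (Fin (n + 1)) →L[ℝ]
      EuclideanSpace ℝ (Fin (n + 1)) →L[ℝ] ℝ)) ∞
    (fun z : M × ℝ => TotalSpace.mk' (EuclideanSpace ℝ (Fin (n + 1)) →L[ℝ]
      EuclideanSpace ℝ (Fin (n + 1)) →L[ℝ] ℝ)
      (E := fun p : M => TangentSpace (𝓡 (n + 1)) p →L[ℝ] TangentSpace (𝓡 (n + 1)) p →L[ℝ] ℝ)
      z.1 ((g z.2).inner z.1))
    (univ ×ˢ Ico 0 ε)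
  smooth_normal : IsSmoothField N
  unit : ∀ t ∈ Ico 0 ε, ∀ p, (g t).inner p (N p) (N p) = 1
  evolution : ∀ t ∈ Ico 0 ε, ∀ (p : M) (v w : TangentSpace (𝓡 (n + 1)) p),
    HasDerivWithinAt (fun s => (g s).inner p v w)
      (C * (g t).inner p (weingarten (g t) N p v) w) (Ico 0 ε) t

namespace IsEGF

variable {F : Foliation n M} {ν : VField n M} {f : ℕ → M → ℝ → ℝ} {ε : ℝ} {g : ℝ → RMetric n M}
  {N : ℝ → VField n M}

theorem normal_eq (h : IsEGF F ν f ε g N) {s t : ℝ} (hs : s ∈ Ico 0 ε) (ht : t ∈ Ico 0 ε) :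
    N s = N t := by
  funext p
  obtain ⟨α, hα⟩ := F.exists_ker_isTangent p
  let G : ℝ → EuclideanSpace ℝ (Fin (n + 1)) →L[ℝ] EuclideanSpace ℝ (Fin (n + 1)) →L[ℝ] ℝ :=
    fun t => (g t).inner p
  have hunique := uniqueDiffOn_Ico 0 ε
  have hG (t) (ht : t ∈ Ico 0 ε) : HasDerivWithinAt G (derivWithin G (Ico 0 ε) t) (Ico 0 ε) t :=
    (differentiableWithinAt_clm_of_apply fun v : EuclideanSpace ℝ (Fin (n + 1)) =>
      differentiableWithinAt_clm_of_apply fun w : EuclideanSpace ℝ (Fin (n + 1)) =>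
        (h.evolution t ht p v w).differentiableWithinAt).hasDerivWithinAt
  have hG' (t) (ht : t ∈ Ico 0 ε) (w : EuclideanSpace ℝ (Fin (n + 1))) :
      derivWithin G (Ico 0 ε) t (N t p) w = 0 := by
    let u : EuclideanSpace ℝ (Fin (n + 1)) := N t p
    have happly : HasDerivWithinAt (fun r => G r u w) (derivWithin G (Ico 0 ε) t u w)
        (Ico 0 ε) t := by
      simpa using ((hG t ht).clm_apply (hasDerivWithinAt_const t _ u)).clm_apply
        (hasDerivWithinAt_const t _ w)
    refine ((hunique t ht).eq_deriv _ happly (h.evolution t ht p (N t p) w)).trans ?_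
    exact Finset.sum_eq_zero fun j _ =>
      mul_eq_zero_of_right _ (bHat_normal ((h.isUnitNormal t ht).unit p) j w)
  exact unitNormal_eq (E := EuclideanSpace ℝ (Fin (n + 1))) (N := fun t => N t p) (ν := ν p)
    (α := α) (convex_Ico 0 ε) hunique (fun t _ => (g t).pos p) hG
    (fun t ht => (h.isUnitNormal t ht).unit p)
    (fun t ht v hv => (h.isUnitNormal t ht).normal p v (hα v hv))
    (fun t ht => (h.isUnitNormal t ht).pos p) (fun t ht => ContinuousLinearMap.ext (hG' t ht))
    hs ht

theorem isSecondFormFlow (h : IsEGF F ν f ε g N) (hε : 0 < ε) (hn : 1 < n) {C : ℝ}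
    (hf₁ : ∀ p t, f 1 p t = C) (hf : ∀ j ≠ 1, ∀ p t, f j p t = 0) :
    IsSecondFormFlow C ε g (N 0) := by
  have h0 : (0 : ℝ) ∈ Ico 0 ε := ⟨le_rfl, hε⟩
  refine ⟨h.smooth, (h.isUnitNormal 0 h0).smooth, fun t ht p => ?_, fun t ht p v w => ?_⟩
  · rw [h.normal_eq h0 ht]
    exact (h.isUnitNormal t ht).unit p
  · have hN := h.isUnitNormal t ht
    have hevolution := h.evolution t ht p v w
    rwa [Finset.sum_eq_single_of_mem 1 (Finset.mem_range.2 hn)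
      (fun j _ hj => by rw [hf j hj, zero_mul]), hf₁, bHat_one hN.smooth hN.unit,
      h.normal_eq ht h0] at hevolution

end IsEGF

end Evolution

section LocalEndomorphisms

variable {E : Type*} [NormedAddCommGroup E] [NormedSpace ℝ E]
  {H : Type*} [TopologicalSpace H] {I : ModelWithCorners ℝ E H}
  {M : Type*} [TopologicalSpace M] [ChartedSpace H M] [IsManifold I 1 M]

/-- The coordinate representation at `y`, in the preferred chart at `x`, of a field `A` of
endomorphisms of the tangent spaces. -/
def localEndo (I : ModelWithCorners ℝ E H) {M : Type*} [TopologicalSpace M] [ChartedSpace H M]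
    [IsManifold I 1 M] (A : (p : M) → TangentSpace I p →L[ℝ] TangentSpace I p) (x : M) (y : E) :
    E →L[ℝ] E :=
  (coordMap I x ((extChartAt I x).symm y)).comp
    ((A ((extChartAt I x).symm y)).comp (coordFrame I x ((extChartAt I x).symm y)))

variable (A : (p : M) → TangentSpace I p →L[ℝ] TangentSpace I p) {x : M} {y : E}

theorem localEndo_apply (u : E) : localEndo I A x y u =
    coordMap I x ((extChartAt I x).symm y)
      (A ((extChartAt I x).symm y) (coordFrame I x ((extChartAt I x).symm y) u)) := rfl

theorem coordFrame_localEndo (hy : y ∈ (extChartAt I x).target) (u : E) :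
    coordFrame I x ((extChartAt I x).symm y) (localEndo I A x y u) =
      A _ (coordFrame I x ((extChartAt I x).symm y) u) :=
  coordFrame_coordMap ((extChartAt I x).map_target hy) _

theorem localEndo_pow (hy : y ∈ (extChartAt I x).target) (i : ℕ) :
    localEndo I A x y ^ i = localEndo I (fun p => A p ^ i) x y := by
  have hp := (extChartAt I x).map_target hy
  induction i with
  | zero => exact ContinuousLinearMap.ext fun u => (coordMap_coordFrame hp u).symm
  | succ i ih =>
    ext u
    rw [pow_succ, ih, mul_apply_eq_comp, localEndo_apply, coordFrame_localEndo A hy,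
      localEndo_apply, pow_succ, mul_apply_eq_comp]

theorem traceCLM_localEndo [FiniteDimensional ℝ E] (hy : y ∈ (extChartAt I x).target) :
    traceCLM E (localEndo I A x y) =
      LinearMap.trace ℝ (TangentSpace I ((extChartAt I x).symm y))
        (A ((extChartAt I x).symm y)).toLinearMap := by
  have : FiniteDimensional ℝ (TangentSpace I ((extChartAt I x).symm y)) :=
    inferInstanceAs (FiniteDimensional ℝ E)
  refine (LinearMap.trace_comp_comm'
    ((A ((extChartAt I x).symm y)).comp (coordFrame I x ((extChartAt I x).symm y))).toLinearMap
    (coordMap I x ((extChartAt I x).symm y)).toLinearMap).trans (congrArg _ ?_)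
  exact LinearMap.ext fun v => congrArg (A ((extChartAt I x).symm y))
    (coordFrame_coordMap ((extChartAt I x).map_target hy) v)

end LocalEndomorphisms

section LocalWeingarten

variable {n : ℕ} {M : Type*} [TopologicalSpace M]
  [ChartedSpace (EuclideanSpace ℝ (Fin (n + 1))) M] [IsManifold (𝓡 (n + 1)) ∞ M]

theorem localBilin_weingarten_add (g : RMetric n M) {N : VField n M} (hN : IsSmoothField N)
    {x : M} {y : EuclideanSpace ℝ (Fin (n + 1))} (hy : y ∈ (extChartAt (𝓡 (n + 1)) x).target)
    (hg : DifferentiableAt ℝ (localBilin (𝓡 (n + 1)) g.inner x) y)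
    {u v : EuclideanSpace ℝ (Fin (n + 1))}
    (hu : localBilin (𝓡 (n + 1)) g.inner x y (localField (𝓡 (n + 1)) N x y) u = 0)
    (hv : localBilin (𝓡 (n + 1)) g.inner x y (localField (𝓡 (n + 1)) N x y) v = 0) :
    localBilin (𝓡 (n + 1)) g.inner x y (localEndo (𝓡 (n + 1)) (weingarten g N) x y u) v
      + localBilin (𝓡 (n + 1)) g.inner x y (localEndo (𝓡 (n + 1)) (weingarten g N) x y v) u =
      -lieDerivBilin (localField (𝓡 (n + 1)) N x) (localBilin (𝓡 (n + 1)) g.inner x) y u v := by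
  rw [localBilin_apply, coordFrame_localField N hy] at hu hv
  rw [← inner_leviCivita_coordFrame g hy (hN.mdifferentiableAt _) hg, localBilin_apply,
    localBilin_apply, coordFrame_localEndo _ hy, coordFrame_localEndo _ hy, weingarten_apply,
    weingarten_apply, tangentialPart_of_inner_eq_zero hu, tangentialPart_of_inner_eq_zero hv,
    map_neg, map_neg, neg_apply, neg_apply, neg_add]

theorem IsSecondFormFlow.isLocalFlow {C ε : ℝ} {g : ℝ → RMetric n M} {N : VField n M}
    (h : IsSecondFormFlow C ε g N) (x : M) :
    IsLocalFlow (extChartAt (𝓡 (n + 1)) x).target ε C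
      (fun z => localBilin (𝓡 (n + 1)) (g z.2).inner x z.1) (localField (𝓡 (n + 1)) N x)
      (fun z => localEndo (𝓡 (n + 1)) (weingarten (g z.2) N) x z.1) := by
  have hsmooth := contDiffOn_localBilin (I := 𝓡 (n + 1)) (β := fun t => (g t).inner) h.smooth x
  have hopen := isOpen_extChartAt_target (I := 𝓡 (n + 1)) x
  exact
    { isOpen := hopen
      contDiffOn_metric := hsmooth
      contDiffOn_normal := contDiffOn_localField h.smooth_normal
      symm := fun z _ u v => (g z.2).symm _ _ _
      pos := fun z hz u hu => (g z.2).pos _ _ fun hframe => hu <| by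
        rw [← coordMap_coordFrame ((extChartAt (𝓡 (n + 1)) x).map_target hz.1) u]
        exact (congrArg _ hframe).trans (map_zero _)
      unit := fun z hz => by
        rw [localBilin_apply, coordFrame_localField N hz.1, h.unit z.2 hz.2]
      evolution := fun z hz u v => by
        simp only [localBilin_apply, coordFrame_localEndo _ hz.1]
        exact h.evolution z.2 hz.2 _ _ _
      apply_normal := fun z hz => by
        rw [localEndo_apply, coordFrame_localField N hz.1, weingarten_normal (h.unit z.2 hz.2 _),
          map_zero]
      koszul := fun z hz u v hu hv => localBilin_weingarten_add (g z.2) h.smooth_normal hz.1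
        (hasFDerivAt_comp_prodMk_left hopen hz
          (hsmooth.differentiableOn (by simp) z hz)).differentiableAt hu hv }

end LocalWeingarten

section CurvesInCharts

variable {E : Type*} [NormedAddCommGroup E] [NormedSpace ℝ E]
  {H : Type*} [TopologicalSpace H] {I : ModelWithCorners ℝ E H}
  {M : Type*} [TopologicalSpace M] [ChartedSpace H M] [IsManifold I 1 M]

theorem localField_extChartAt (V : (p : M) → TangentSpace I p) {x p : M}
    (hp : p ∈ (extChartAt I x).source) :
    localField I V x (extChartAt I x p) = coordMap I x p (V p) :=
  congrArg (fun q => (coordMap I x q (V q) : E)) ((extChartAt I x).left_inv hp)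

theorem hasDerivWithinAt_extChartAt_comp {V : (p : M) → TangentSpace I p} {x : M} {γ : ℝ → M}
    {S : Set ℝ} {s : ℝ}
    (hγ : HasMFDerivWithinAt 𝓘(ℝ, ℝ) I γ S s ((1 : ℝ →L[ℝ] ℝ).smulRight (V (γ s))))
    (hs : γ s ∈ (extChartAt I x).source) :
    HasDerivWithinAt (fun r => extChartAt I x (γ r))
      (localField I V x (extChartAt I x (γ s))) S s := by
  rw [extChartAt_source] at hs
  have hchart : HasMFDerivAt I 𝓘(ℝ, E) (extChartAt I x) (γ s) (coordMap I x (γ s)) := by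
    rw [coordMap, TangentBundle.continuousLinearMapAt_trivializationAt hs]
    exact (mdifferentiableAt_extChartAt hs).hasMFDerivAt
  have hcomp : HasFDerivWithinAt (fun r => extChartAt I x (γ r))
      ((1 : ℝ →L[ℝ] ℝ).smulRight (coordMap I x (γ s) (V (γ s)))) S s :=
    (hchart.comp_hasMFDerivWithinAt s hγ).hasFDerivWithinAt.congr_fderiv
      (ContinuousLinearMap.ext fun r : ℝ => map_smul (coordMap I x (γ s)) r (V (γ s)))
  rw [localField_extChartAt V (by rwa [extChartAt_source])]
  simpa using hcomp.hasDerivWithinAt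

theorem eq_of_hasMFDerivWithinAt_zero {γ : ℝ → M} {S : Set ℝ} (hS : Convex ℝ S)
    (hγ : ∀ s ∈ S, HasMFDerivWithinAt 𝓘(ℝ, ℝ) I γ S s 0) {a b : ℝ} (ha : a ∈ S) (hb : b ∈ S) :
    γ a = γ b := by
  refine hS.isPreconnected.induction₂ (fun a b => γ a = γ b) (fun s hs => ?_)
    (fun _ _ _ _ _ _ => Eq.trans) (fun _ _ _ _ => Eq.symm) ha hb
  have hsource : ∀ᶠ r in 𝓝[S] s, γ r ∈ (extChartAt I (γ s)).source :=
    (hγ s hs).continuousWithinAt.eventually_mem (extChartAt_source_mem_nhds (γ s))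
  obtain ⟨δ, hδ, hball⟩ := Metric.mem_nhdsWithin_iff.1 hsource
  have hderiv (r) (hr : r ∈ Metric.ball s δ ∩ S) :
      HasDerivWithinAt (fun r => extChartAt I (γ s) (γ r)) 0 (Metric.ball s δ ∩ S) r := by
    have hr' := hasDerivWithinAt_extChartAt_comp (V := fun _ => 0) (((hγ r hr.2).mono
      (inter_subset_right (s := Metric.ball s δ))).congr_mfderiv
        (ContinuousLinearMap.smulRight_zero _).symm) (hball hr)
    rwa [localField_extChartAt _ (hball hr), map_zero] at hr'
  filter_upwards [inter_mem_nhdsWithin S (Metric.ball_mem_nhds s hδ)] with r hr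
  exact (extChartAt I (γ s)).injOn (mem_extChartAt_source (γ s)) (hball ⟨hr.2, hr.1⟩)
    (eq_of_hasDerivWithinAt_zero (F := E) ((convex_ball s δ).inter hS) hderiv
      ⟨Metric.mem_ball_self hδ, hs⟩ ⟨hr.2, hr.1⟩)

end CurvesInCharts

section SpaceTime

variable {n : ℕ} {M : Type*} [TopologicalSpace M]
  [ChartedSpace (EuclideanSpace ℝ (Fin (n + 1))) M] {C : ℝ} {N : VField n M}

theorem exists_isFlow_spaceTimeField (C : ℝ) (hN : IsCompleteField N) :
    ∃ φ : ℝ → M × ℝ → M × ℝ, IsFlow (spaceTimeField C N) φ := by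
  choose γ hγ0 hγ using hN
  refine ⟨fun s z => (γ z.1 (s * (C / 2)), z.2 + s), fun z => ?_, fun z s => ?_⟩
  · simp only [zero_mul, hγ0, add_zero]
  · have htime : HasMFDerivAt 𝓘(ℝ, ℝ) 𝓘(ℝ, ℝ) (fun s : ℝ => z.2 + s) s
        ((1 : ℝ →L[ℝ] ℝ).smulRight (1 : ℝ)) :=
      ((hasDerivAt_id s).const_add z.2).hasFDerivAt.hasMFDerivAt
    exact (((hγ z.1).comp_mul (C / 2) s).prodMk htime).congr_mfderiv
      (ContinuousLinearMap.ext fun r => rfl)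

variable {Γ : ℝ → M × ℝ} {S : Set ℝ}

theorem isMIntegralCurveOn_fst (hΓ : IsMIntegralCurveOn Γ (spaceTimeField C N) S) :
    IsMIntegralCurveOn (fun s => (Γ s).1) (fun p => (C / 2) • N p) S := fun s hs =>
  ((hasMFDerivAt_fst (x := Γ s)).comp_hasMFDerivWithinAt s (hΓ s hs)).congr_mfderiv
    (ContinuousLinearMap.ext fun _ => rfl)

theorem hasDerivWithinAt_snd (hΓ : IsMIntegralCurveOn Γ (spaceTimeField C N) S) {s : ℝ}
    (hs : s ∈ S) : HasDerivWithinAt (fun s => (Γ s).2) 1 S s := by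
  have hsnd : HasFDerivWithinAt (fun s => (Γ s).2) ((1 : ℝ →L[ℝ] ℝ).smulRight (1 : ℝ)) S s :=
    ((hasMFDerivAt_snd (x := Γ s)).comp_hasMFDerivWithinAt s
      (hΓ s hs)).hasFDerivWithinAt.congr_fderiv (ContinuousLinearMap.ext fun _ => rfl)
  simpa using hsnd.hasDerivWithinAt

theorem snd_sub_eq_snd_sub (hS : Convex ℝ S)
    (hΓ : IsMIntegralCurveOn Γ (spaceTimeField C N) S) {r s : ℝ} (hr : r ∈ S) (hs : s ∈ S) :
    (Γ r).2 - r = (Γ s).2 - s :=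
  eq_of_hasDerivWithinAt_zero (f := fun s => (Γ s).2 - s) hS
    (fun s hs => ((hasDerivWithinAt_snd hΓ hs).fun_sub (hasDerivWithinAt_id s S)).congr_deriv
      (sub_self 1)) hr hs

end SpaceTime

namespace IsSecondFormFlow

variable {n : ℕ} {M : Type*} [TopologicalSpace M]
  [ChartedSpace (EuclideanSpace ℝ (Fin (n + 1))) M] [IsManifold (𝓡 (n + 1)) ∞ M] {C ε : ℝ}
  {g : ℝ → RMetric n M} {N : VField n M}

theorem powerSum_succ_eq_traceCLM (h : IsSecondFormFlow C ε g N) {t : ℝ} (ht : t ∈ Ico 0 ε)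
    {x p : M} (hp : p ∈ (extChartAt (𝓡 (n + 1)) x).source) (i : ℕ) :
    powerSum (g t) N (i + 1) p = traceCLM (EuclideanSpace ℝ (Fin (n + 1)))
      (localEndo (𝓡 (n + 1)) (weingarten (g t) N) x (extChartAt (𝓡 (n + 1)) x p) ^ (i + 1)) := by
  have hy := (extChartAt (𝓡 (n + 1)) x).map_source hp
  rw [localEndo_pow _ hy, traceCLM_localEndo _ hy, ← powerSum_succ (h.unit t ht _),
    (extChartAt (𝓡 (n + 1)) x).left_inv hp]

theorem continuousOn_powerSum_succ (h : IsSecondFormFlow C ε g N) (hC : C ≠ 0) (i : ℕ) :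
    ContinuousOn (fun z : M × ℝ => powerSum (g z.2) N (i + 1) z.1) (univ ×ˢ Ico 0 ε) := by
  intro z hz
  let κ : M × ℝ → EuclideanSpace ℝ (Fin (n + 1)) × ℝ :=
    Prod.map (extChartAt (𝓡 (n + 1)) z.1) id
  have hsource : ∀ᶠ w in 𝓝[univ ×ˢ Ico 0 ε] z, w.1 ∈ (extChartAt (𝓡 (n + 1)) z.1).source :=
    nhdsWithin_le_nhds (continuousAt_fst.eventually_mem (extChartAt_source_mem_nhds z.1))
  have hκ : Tendsto κ (𝓝[univ ×ˢ Ico 0 ε] z)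
      (𝓝[(extChartAt (𝓡 (n + 1)) z.1).target ×ˢ Ico 0 ε] (κ z)) := by
    refine tendsto_nhdsWithin_iff.2 ⟨((continuousAt_extChartAt z.1).prodMap
      continuousAt_id).continuousWithinAt, ?_⟩
    filter_upwards [hsource, self_mem_nhdsWithin] with w hw hwt
    exact ⟨(extChartAt (𝓡 (n + 1)) z.1).map_source hw, hwt.2⟩
  refine ContinuousWithinAt.congr_of_eventuallyEq
    (((h.isLocalFlow z.1).continuousOn_traceCLM_pow hC (i + 1) (κ z)
      ⟨mem_extChartAt_target z.1, hz.2⟩).tendsto.comp hκ) ?_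
    (h.powerSum_succ_eq_traceCLM hz.2 (mem_extChartAt_source z.1) i)
  filter_upwards [hsource, self_mem_nhdsWithin] with w hw hwt
  exact h.powerSum_succ_eq_traceCLM hwt.2 hw i

theorem hasDerivAt_powerSum_succ (h : IsSecondFormFlow C ε g N) (hC : C ≠ 0) {Γ : ℝ → M × ℝ}
    {S : Set ℝ} (hΓ : IsMIntegralCurveOn Γ (spaceTimeField C N) S) {s : ℝ} (hS : S ∈ 𝓝 s)
    (hs : (Γ s).2 ∈ Ioo 0 ε) (i : ℕ) :
    HasDerivAt (fun r => powerSum (g (Γ r).2) N (i + 1) (Γ r).1) 0 s := by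
  have hsS := mem_of_mem_nhds hS
  have hfst := hasDerivWithinAt_extChartAt_comp (V := fun p => (C / 2) • N p)
    (isMIntegralCurveOn_fst hΓ s hsS) (mem_extChartAt_source (I := 𝓡 (n + 1)) (Γ s).1)
  have hz := ((hfst.congr_deriv (map_smul _ _ _)).prodMk (hasDerivWithinAt_snd hΓ hsS)).hasDerivAt
    hS
  have hcont := (hΓ.continuousWithinAt hsS).continuousAt hS
  refine ((h.isLocalFlow (Γ s).1).hasDerivAt_traceCLM_pow hC
    ⟨mem_extChartAt_target (Γ s).1, hs⟩ hz i).congr_of_eventuallyEq ?_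
  filter_upwards [hcont.fst.eventually_mem (extChartAt_source_mem_nhds (I := 𝓡 (n + 1)) (Γ s).1),
    hcont.snd.eventually_mem (Ioo_mem_nhds hs.1 hs.2)] with r hr hrt
  exact h.powerSum_succ_eq_traceCLM (Ioo_subset_Ico_self hrt) hr i

theorem metric_eq (h : IsSecondFormFlow 0 ε g N) {s t : ℝ} (hs : s ∈ Ico 0 ε)
    (ht : t ∈ Ico 0 ε) : g s = g t := by
  have hinner : (g s).inner = (g t).inner := funext fun p => ContinuousLinearMap.ext fun v =>
    ContinuousLinearMap.ext fun w => eq_of_hasDerivWithinAt_zero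
      (f := fun t => (g t).inner p v w) (convex_Ico 0 ε)
      (fun r hr => by simpa using h.evolution r hr p v w) hs ht
  generalize g s = a at hinner
  generalize g t = b at hinner
  cases a
  cases b
  cases hinner
  rfl

theorem powerSum_eq_powerSum (h : IsSecondFormFlow C ε g N) {a b : ℝ} (hab : a ≤ b)
    {Γ : ℝ → M × ℝ} (hΓ : IsMIntegralCurveOn Γ (spaceTimeField C N) (Icc a b))
    (ha : 0 ≤ (Γ a).2) (hb : (Γ b).2 < ε) (i : ℕ) :
    powerSum (g (Γ a).2) N i (Γ a).1 = powerSum (g (Γ b).2) N i (Γ b).1 := by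
  have hsnd {r s} (hr : r ∈ Icc a b) (hs : s ∈ Icc a b) :=
    snd_sub_eq_snd_sub (convex_Icc a b) hΓ hr hs
  have haS := left_mem_Icc.2 hab
  have hbS := right_mem_Icc.2 hab
  have htime (s) (hs : s ∈ Icc a b) : (Γ s).2 ∈ Ico 0 ε :=
    ⟨by linarith [hsnd haS hs, hs.1], by linarith [hsnd hbS hs, hs.2]⟩
  obtain _ | i := i
  · rw [powerSum_zero (h.unit _ (htime a haS) _), powerSum_zero (h.unit _ (htime b hbS) _)]
  obtain rfl | hC := eq_or_ne C 0
  · have hfst : (Γ a).1 = (Γ b).1 := eq_of_hasMFDerivWithinAt_zero (convex_Icc a b)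
      (fun s hs => (isMIntegralCurveOn_fst hΓ s hs).congr_mfderiv
        (ContinuousLinearMap.ext fun r : ℝ =>
          (by simp : r • ((0 / 2 : ℝ) • N (Γ s).1) = 0))) haS hbS
    rw [hfst, h.metric_eq (htime a haS) (htime b hbS)]
  obtain rfl | hlt := hab.eq_or_lt
  · rfl
  obtain ⟨c, -, hc⟩ := exists_hasDerivAt_eq_slope
    (fun s => powerSum (g (Γ s).2) N (i + 1) (Γ s).1) (fun _ => 0) hlt
    ((h.continuousOn_powerSum_succ hC i).comp hΓ.continuousOn fun s hs => ⟨mem_univ _, htime s hs⟩)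
    (fun s hs => h.hasDerivAt_powerSum_succ hC hΓ (Icc_mem_nhds hs.1 hs.2)
      ⟨by linarith [hsnd haS (Ioo_subset_Icc_self hs), hs.1],
        (htime s (Ioo_subset_Icc_self hs)).2⟩ i)
  rw [eq_comm, div_eq_zero_iff, or_iff_left (sub_ne_zero.2 hlt.ne'), sub_eq_zero] at hc
  exact hc.symm

end IsSecondFormFlow

section Completeness

variable {E : Type*} [NormedAddCommGroup E] [NormedSpace ℝ E]

theorem exists_eventually_eq_hasDerivAt_mem [CompleteSpace E] {f : E → E} {y : E}
    (hf : ContDiffAt ℝ 1 f y) {U : Set E} (hU : U ∈ 𝓝 y) :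
    ∃ α : E → ℝ → E, ∀ᶠ z : E × ℝ in 𝓝 (y, 0),
      α z.1 0 = z.1 ∧ HasDerivAt (α z.1) (f (α z.1 z.2)) z.2 ∧ α z.1 z.2 ∈ U := by
  obtain ⟨δ, hδ, _, r, _, _, hr, hpl⟩ := IsPicardLindelof.of_contDiffAt_one hf
  obtain ⟨α, hα, hcont⟩ :=
    (hpl 0).exists_forall_mem_closedBall_eq_hasDerivWithinAt_continuousOn
  have hball : Metric.closedBall y r ∈ 𝓝 y := Metric.closedBall_mem_nhds y hr
  have htime : Icc (0 - δ) (0 + δ) ∈ 𝓝 0 := Icc_mem_nhds (by linarith) (by linarith)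
  have hmem : ∀ᶠ z in 𝓝 (y, (0 : ℝ)), α z ∈ U :=
    (hcont.continuousAt (prod_mem_nhds hball htime)).eventually_mem
      (by rwa [(hα y (mem_of_mem_nhds hball)).1])
  refine ⟨fun x t => α (x, t), ?_⟩
  filter_upwards [hmem, (eventually_mem_set.2 hball).prod_inl_nhds 0,
    (eventually_mem_nhds_iff.2 htime).prod_inr_nhds y] with z hzU hz hzt
  exact ⟨(hα z.1 hz).1, ((hα z.1 hz).2 z.2 (mem_of_mem_nhds hzt)).hasDerivAt hzt, hzU⟩

variable {H : Type*} [TopologicalSpace H] {I : ModelWithCorners ℝ E H} [I.Boundaryless]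
  {M : Type*} [TopologicalSpace M] [ChartedSpace H M] [IsManifold I ∞ M]
  {V : (p : M) → TangentSpace I p}

theorem isMIntegralCurveOn_extChartAt_symm_comp {x : M} {α : ℝ → E} {S : Set ℝ}
    (htarget : MapsTo α S (extChartAt I x).target)
    (hα : ∀ s ∈ S, HasDerivWithinAt α (localField I V x (α s)) S s) :
    IsMIntegralCurveOn (fun s => (extChartAt I x).symm (α s)) V S := fun s hs =>
  ((hasMFDerivAt_extChartAt_symm (htarget hs)).comp_hasMFDerivWithinAt s
    (hα s hs).hasFDerivWithinAt.hasMFDerivWithinAt).congr_mfderiv <|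
      ContinuousLinearMap.ext fun r : ℝ =>
        (map_smul (coordFrame I x ((extChartAt I x).symm (α s))) r _).trans
          (congrArg (r • ·) (coordFrame_localField V (htarget hs)))

theorem eventually_exists_isMIntegralCurveOn_Ioo [CompleteSpace E]
    (hV : ContMDiff I I.tangent ∞ (fun p => (⟨p, V p⟩ : TangentBundle I M))) (x : M) :
    ∀ᶠ z : ℝ × M in 𝓝 (0, x), ∃ γ : ℝ → M, γ 0 = z.2 ∧
      IsMIntegralCurveOn γ V (Ioo (-z.1) z.1) := by
  have htarget := extChartAt_target_mem_nhds (I := I) x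
  obtain ⟨α, hα⟩ := exists_eventually_eq_hasDerivAt_mem
    (((contDiffOn_localField hV).contDiffAt htarget).of_le (by simp)) htarget
  rw [nhds_prod_eq, eventually_prod_iff] at hα
  obtain ⟨Q, hQ, P, hP, h⟩ := hα
  obtain ⟨δ, hδ, hδP⟩ := Metric.eventually_nhds_iff_ball.1 hP
  filter_upwards [(eventually_lt_nhds hδ).prod_inl_nhds x,
    ((continuousAt_extChartAt x).eventually hQ).prod_inr_nhds 0,
    (eventually_mem_set.2 (extChartAt_source_mem_nhds (I := I) x)).prod_inr_nhds 0] with z hzδ hzQ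
    hzx
  have hcurve (s) (hs : s ∈ Ioo (-z.1) z.1) :=
    h hzQ (hδP s (by rw [Real.ball_eq_Ioo]; constructor <;> linarith [hs.1, hs.2]))
  refine ⟨fun s => (extChartAt I x).symm (α (extChartAt I x z.2) s), ?_,
    isMIntegralCurveOn_extChartAt_symm_comp (fun s hs => (hcurve s hs).2.2)
      fun s hs => (hcurve s hs).2.1.hasDerivWithinAt⟩
  exact (congrArg _ (h hzQ (hδP 0 (Metric.mem_ball_self hδ))).1).trans
    ((extChartAt I x).left_inv hzx)

theorem isCompleteField_of_compactSpace [CompleteSpace E] [T2Space M] [CompactSpace M]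
    (hV : ContMDiff I I.tangent ∞ (fun p => (⟨p, V p⟩ : TangentBundle I M))) :
    IsCompleteField V := by
  have huniform : ∀ᶠ δ in 𝓝 (0 : ℝ), ∀ p ∈ univ, ∃ γ : ℝ → M, γ 0 = p ∧
      IsMIntegralCurveOn γ V (Ioo (-δ) δ) :=
    isCompact_univ.eventually_forall_of_forall_eventually
      fun x _ => eventually_exists_isMIntegralCurveOn_Ioo hV x
  obtain ⟨δ, hδpos, hδ⟩ :=
    ((eventually_nhdsWithin_of_eventually_nhds huniform).and
      self_mem_nhdsWithin : ∀ᶠ δ in 𝓝[>] (0 : ℝ), _).exists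
  exact exists_isMIntegralCurve_of_isMIntegralCurveOn (hV.of_le (by simp)) hδ
    fun p => hδpos p (mem_univ p)

end Completeness

end EGF

end

theorem corollary3 {n : ℕ} (hn : 2 ≤ n) {M : Type*} [TopologicalSpace M] [T2Space M]
    [ChartedSpace (EuclideanSpace ℝ (Fin (n + 1))) M] [IsManifold (𝓡 (n + 1)) ∞ M]
    (F : EGF.Foliation n M) (ν : EGF.VField n M) (hν : EGF.IsTransverseOrientation F ν)
    (C : ℝ) (f : ℕ → M → ℝ → ℝ) (hf₁ : ∀ p t, f 1 p t = C) (hf : ∀ j ≠ 1, ∀ p t, f j p t = 0)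
    (ε : ℝ) (hε : 0 < ε) (g : ℝ → EGF.RMetric n M) (N : ℝ → EGF.VField n M)
    (hg : EGF.IsEGF F ν f ε g N) :
    -- `τ_i^t = τ_i^0 ∘ φ_{-t}` for the flow `φ` of `∂_t + (C/2) N`, which maps `M × {t}` to `M × {0}`
    (∀ φ : ℝ → M × ℝ → M × ℝ, EGF.IsFlow (EGF.spaceTimeField C (N 0)) φ →
      ∀ t ∈ Set.Ico 0 ε, ∀ p : M, (φ (-t) (p, t)).2 = 0 ∧
        ∀ i : ℕ, EGF.powerSum (g t) (N t) i p
          = EGF.powerSum (g 0) (N 0) i (φ (-t) (p, t)).1) ∧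
    -- the same for the local flow, wherever it is defined, without completeness
    (∀ t ∈ Set.Ico 0 ε, ∀ (p : M) (Γ : ℝ → M × ℝ), Γ 0 = (p, t) →
      IsMIntegralCurveOn Γ (EGF.spaceTimeField C (N 0)) (Set.Icc (-t) 0) →
        (Γ (-t)).2 = 0 ∧
        ∀ i : ℕ, EGF.powerSum (g t) (N t) i p = EGF.powerSum (g 0) (N 0) i (Γ (-t)).1) ∧
    -- if `M` is compact or `N` is complete, the flow exists, and constant power sums stay constant
    ((CompactSpace M ∨ EGF.IsCompleteField (N 0)) →
      (∃ φ : ℝ → M × ℝ → M × ℝ, EGF.IsFlow (EGF.spaceTimeField C (N 0)) φ) ∧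
      ∀ (i : ℕ) (c : ℝ), (∀ p, EGF.powerSum (g 0) (N 0) i p = c) →
        ∀ t ∈ Set.Ico 0 ε, ∀ p, EGF.powerSum (g t) (N t) i p = c) := by
  have h := hg.isSecondFormFlow hε hn hf₁ hf
  have hlocal : ∀ t ∈ Set.Ico 0 ε, ∀ (p : M) (Γ : ℝ → M × ℝ), Γ 0 = (p, t) →
      IsMIntegralCurveOn Γ (EGF.spaceTimeField C (N 0)) (Set.Icc (-t) 0) →
        (Γ (-t)).2 = 0 ∧
        ∀ i : ℕ, EGF.powerSum (g t) (N t) i p = EGF.powerSum (g 0) (N 0) i (Γ (-t)).1 := by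
    intro t ht p Γ hΓ0 hΓ
    have ht0 : -t ≤ 0 := neg_nonpos.2 ht.1
    have hsnd : (Γ (-t)).2 = 0 := by
      simpa [hΓ0] using EGF.snd_sub_eq_snd_sub (convex_Icc (-t) 0) hΓ (Set.left_mem_Icc.2 ht0)
        (Set.right_mem_Icc.2 ht0)
    refine ⟨hsnd, fun i => ?_⟩
    have hpow := h.powerSum_eq_powerSum ht0 hΓ hsnd.ge (by simpa only [hΓ0] using ht.2) i
    rw [hg.normal_eq ht ⟨le_rfl, hε⟩]
    simpa only [hsnd, hΓ0] using hpow.symm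
  have hglobal (φ) (hφ : EGF.IsFlow (EGF.spaceTimeField C (N 0)) φ) (t) (ht : t ∈ Set.Ico 0 ε)
      (p : M) := hlocal t ht p (fun s => φ s (p, t)) (hφ.zero _)
    ((hφ.orbit (p, t)).isMIntegralCurveOn _)
  refine ⟨hglobal, hlocal, fun hcomplete => ?_⟩
  obtain ⟨φ, hφ⟩ := EGF.exists_isFlow_spaceTimeField C
    (hcomplete.elim (fun _ => EGF.isCompleteField_of_compactSpace h.smooth_normal) id)
  exact ⟨⟨φ, hφ⟩, fun i c hc t ht p => ((hglobal φ hφ t ht p).2 i).trans (hc _)⟩
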